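/- **Setting (chromatic correlation clustering, CCC).** Let $V,L$ be finite sets, $\gamma\notin L$, and $\phi:\binom V2\to L\cup\{\gamma\}$. A chromatic clustering is a partition of $V$ with a color in $L$ for every part; put $\Phi(uv)=c$ if $u\ne v$ lie in a common part of color $c$, and $\Phi(uv)=\gamma$ if they lie in different parts. Its cost is the number of edges $uv$ with $\Phi(uv)\neq\phi(uv)$, and $\mathrm{opt}$ is the minimum cost. A feasible solution of the chromatic cluster LP is a family $z_S^c\ge 0$ ($c\in L$, $\emptyset\ne S\subseteq V$) such that, with $x_u^c=1-\sum_{S\ni u}z_S^c$ and $x_{uv}^c=1-\sum_{S\ni u,v}z_S^c$ (so $x_{uu}^c=x_u^c$), one has $\sum_{c}(1-x_u^c)=1$ for all $u\in V$. Its objective is $\mathrm{obj}(z)=\sum_{\phi(uv)\in L}x_{uv}^{\phi(uv)}+\sum_{\phi(uv)=\gamma}\sum_{c\in L}(1-x_{uv}^c)$. **Algorithm.** Let $\alpha\in[3/2,2)$ and let $f^+,f^-,f^\circ:[0,1]\to[0,1]$ be rounding functions. Let $V_c=\{u: x_u^c<1/2\}$. For $c\in L$ and an edge $uv$ call $uv$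 a $+$, $-$ or $\circ$ edge if $\phi(uv)=c$, $\phi(uv)=\gamma$ or $\phi(uv)\in L\setminus\{c\}$, let $p_{uv}$ be $f^+(x^c_{uv})$, $f^-(x^c_{uv})$ or $f^\circ(x^c_{uv})$ accordingly, and let $p_{uu}=0$. * *Cluster-based rounding:* start with $\Phi\equiv\gamma$, $V'=V$; while $V'\ne\emptyset$, draw $(c,S)$ with probability proportional to $z_S^c$; if $V'\cap S\neq\emptyset$, make $V'\cap S$ a cluster of color $c$ and replace $V'$ by $V'\setminus S$. * *Pivot-based rounding:* start with $\Phi\equiv\gamma$; for each $c\in L$, while $V_c\neq\emptyset$, choose a pivot $u\in V_c$ uniformly at random, let $C$ consist of $u$ and of each $v\in V_c\setminus\{u\}$ independently with probability $1-p_{uv}$, make $C$ a cluster of color $c$ and remove it from $V_c$. (Vertices in no cluster become singletons.) * *Mixed algorithm:* run cluster-based rounding with probability $\alpha/2$, and pivot-based rounding otherwise. **Triangle inequality.** Fix $c$ and $u,v,w\in V_c$. For $u\neq v$ let $e.cost_w(uv)$ be $p_{uw}(1-p_{vw})+(1-p_{uw})p_{vw}$, $(1-p_{uw})(1-p_{vw})$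 or $1-p_{uw}p_{vw}$ for $uv$ a $+$, $-$ or $\circ$ edge, and let $e.lp_w(uv)=(1-p_{uw}p_{vw})\,b(uv)$, where $$b(uv)=\frac{\alpha}{1-\alpha/2}\cdot\begin{cases}\dfrac{(x_{uv}^c)^2}{1+x_{uv}^c}& uv\text{ is a }+\text{ edge},\\[2mm] \dfrac{(1+2x_{uv}^c)(1-x_{uv}^c)}{2(1+x_{uv}^c)}& uv\text{ is a }-\text{ edge},\\[2mm] \dfrac{m^2}{1+m},\ \ m=\max\{\tfrac12,1-x_{uv}^c,1-x_{vw}^c,1-x_{wu}^c\}& uv\text{ is a }\circ\text{ edge};\end{cases}$$ put $e.cost_w(uu)=e.lp_w(uu)=0$. Let $ALG(uvw)=e.cost_w(uv)+e.cost_u(vw)+e.cost_v(wu)$ and $LP(uvw)=e.lp_w(uv)+e.lp_u(vw)+e.lp_v(wu)$. **Lemma.** Let $\phi$ be an instance and $z$ a feasible solution of its chromatic cluster LP such that $ALG(uvw)\le LP(uvw)$ for all $c\in L$ and all $u,v,w\in V_c$, not necessarily distinct. Then the mixed algorithm terminates with probability $1$, after an expected number of at most $|V|^2$ iterations of its while loops;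 its output is a chromatic clustering; and for every $\varepsilon>0$, if $z$ is near-optimal in the sense that $\mathrm{obj}(z)\le(1+\varepsilon/\alpha)\,\mathrm{opt}$, then the expected cost of its output is at most $(\alpha+\varepsilon)\,\mathrm{opt}$. In particular, if the triangle inequality holds for all configurations, then the mixed algorithm is an $(\alpha+\varepsilon)$-approximation algorithm for CCC. -/

import Mathlib

open scoped ENNReal

noncomputable section

namespace CCC

variable {V L : Type*} [Fintype V] [DecidableEq V] [Fintype L] [DecidableEq L]

/-! ## The problem

An instance is a map `φ : Sym2 V → Option L` on unordered pairs; `some c` is the color `c ∈ L`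
and `none` is the extra color `γ`.  Values on the diagonal pairs `s(u, u)` never matter. -/

/-- The edges `uv`, i.e. the unordered pairs of distinct vertices. -/
def edges (V : Type*) [Fintype V] [DecidableEq V] : Finset (Sym2 V) :=
  Finset.univ.filter fun e => ¬ e.IsDiag

/-- A partition of the vertices, given by the relation of lying in the same cluster, together
with a color for every cluster. -/
structure ChromaticClustering (V L : Type*) where
  same : Setoid V
  color : Quotient same → L

open Classical in
/-- The clustering as a function on pairs: the color of the common cluster, or `none` (`= γ`) for
two vertices in different clusters. -/
def ChromaticClustering.label {V L : Type*} (K : ChromaticClustering V L) : Sym2 V → Option L :=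
  Sym2.lift ⟨fun u v => if K.same u v then some (K.color (Quotient.mk K.same u)) else none, by
    intro u v
    by_cases h : K.same u v
    · have h' : K.same v u := K.same.symm h
      have hq : Quotient.mk K.same u = Quotient.mk K.same v := Quotient.sound h
      simp [h, h', hq]
    · have h' : ¬ K.same v u := fun hv => h (K.same.symm hv)
      simp [h, h']⟩

/-- Number of disagreements: the positive edges whose end points are separated or lie in a common
cluster of another color, plus the negative edges inside a cluster. -/
def cost (φ Φ : Sym2 V → Option L) : ℕ :=
  ((edges V).filter fun e => φ e ≠ none ∧ Φ e ≠ φ e).card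
    + ((edges V).filter fun e => φ e = none ∧ Φ e ≠ none).card

/-- The optimal value of the instance. -/
def opt (φ : Sym2 V → Option L) : ℕ := ⨅ K : ChromaticClustering V L, cost φ K.label

/-- `Φ` is (on edges) the function on pairs of some chromatic clustering. -/
def IsClustering (Φ : Sym2 V → Option L) : Prop :=
  ∃ K : ChromaticClustering V L, ∀ e ∈ edges V, Φ e = K.label e

/-! ## The chromatic cluster LP -/

/-- `x_u^c`, determined by `z` through `∑_{S ∋ u} z_S^c = 1 - x_u^c`. -/
def xVertex (z : L → Finset V → ℝ) (c : L) (u : V) : ℝ :=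
  1 - ∑ S ∈ Finset.univ.filter (fun S : Finset V => u ∈ S), z c S

/-- `x_{uv}^c`, determined by `z` through `∑_{S ∋ u, v} z_S^c = 1 - x_{uv}^c`.  On the diagonal
this formula gives `x_{uu}^c = x_u^c`. -/
def xEdge (z : L → Finset V → ℝ) (c : L) (e : Sym2 V) : ℝ :=
  1 - ∑ S ∈ Finset.univ.filter (fun S : Finset V => ∀ a ∈ e, a ∈ S), z c S

/-- Feasible solutions of the chromatic cluster LP.  Only the values `z c S` with `S` nonempty are
variables of the LP; `z c ∅` is never used. -/
structure LPSolution (V L : Type*) [Fintype V] [DecidableEq V] [Fintype L] where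
  z : L → Finset V → ℝ
  nonneg : ∀ c S, S.Nonempty → 0 ≤ z c S
  normalized : ∀ u, ∑ c, (1 - xVertex z c u) = 1

/-- The objective of the chromatic cluster LP. -/
def lpObj (φ : Sym2 V → Option L) (z : L → Finset V → ℝ) : ℝ :=
  ∑ e ∈ edges V,
    match φ e with
    | some c => xEdge z c e
    | none => ∑ c, (1 - xEdge z c e)

/-! ## While loops with random bodies -/

/-- The state after at most `k` iterations of `while ¬ halted do body`. -/
def loopRun {σ : Type*} (halted : σ → Prop) [DecidablePred halted] (body : σ → PMF σ) :
    ℕ → σ → PMF σ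
  | 0, s => PMF.pure s
  | k + 1, s => if halted s then PMF.pure s else (body s).bind (loopRun halted body k)

/-- The probability that the loop, started in `s`, terminates with output `b`. -/
def loopLaw {σ β : Type*} (halted : σ → Prop) [DecidablePred halted] (body : σ → PMF σ)
    (output : σ → β) (s : σ) (b : β) : ℝ≥0∞ :=
  ⨆ k, (loopRun halted body k s).toOuterMeasure {t | halted t ∧ output t = b}

/-- The expected number of iterations of the loop: the sum over `k` of the probability that the
loop is still running after `k` iterations. -/
def loopIterations {σ : Type*} (halted : σ → Prop) [DecidablePred halted] (body : σ → PMF σ)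
    (s : σ) : ℝ≥0∞ :=
  ∑' k, (loopRun halted body k s).toOuterMeasure {t | ¬ halted t}

/-- The assignment `Φ(C²) ← c`. -/
def paint (Φ : Sym2 V → Option L) (C : Finset V) (c : L) : Sym2 V → Option L :=
  fun e => if ∀ a ∈ e, a ∈ C then some c else Φ e

/-! ## Cluster-based rounding -/

/-- The weight of the pair `(c, S)`, which is `z_S^c` for nonempty `S`. -/
def weight (z : L → Finset V → ℝ) (q : L × Finset V) : ℝ≥0∞ :=
  if q.2.Nonempty then ENNReal.ofReal (z q.1 q.2) else 0

theorem weight_tsum_ne_top (z : L → Finset V → ℝ) : ∑' q, weight z q ≠ ∞ := by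
  rw [tsum_fintype]
  refine (ENNReal.sum_lt_top.2 fun q _ => ?_).ne
  unfold weight
  split_ifs <;> simp

theorem weight_tsum_ne_zero (z : LPSolution V L) {R : Finset V} (hR : R.Nonempty) :
    ∑' q, weight z.z q ≠ 0 := by
  obtain ⟨u, _⟩ := hR
  intro h
  rw [ENNReal.tsum_eq_zero] at h
  have hz : ∀ c S, u ∈ S → z.z c S = 0 := by
    intro c S hS
    have h1 := h (c, S)
    have hne : S.Nonempty := ⟨u, hS⟩
    simp only [weight, hne, if_true, ENNReal.ofReal_eq_zero] at h1
    exact le_antisymm h1 (z.nonneg c S hne)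
  have h2 := z.normalized u
  have h3 : ∀ c, 1 - xVertex z.z c u = 0 := by
    intro c
    have : ∑ S ∈ Finset.univ.filter (fun S : Finset V => u ∈ S), z.z c S = 0 :=
      Finset.sum_eq_zero fun S hS => hz c S (by simpa using hS)
    simp [xVertex, this]
  simp [h3] at h2

/-- A pair `(c, S)`, `S ≠ ∅`, with probability proportional to `z_S^c`. -/
def drawCluster (z : LPSolution V L) {R : Finset V} (hR : R.Nonempty) : PMF (L × Finset V) :=
  PMF.normalize (weight z.z) (weight_tsum_ne_zero z hR) (weight_tsum_ne_top z.z)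

/-- One iteration of the loop; the state is `(V', Φ)`. -/
def clusterBody (z : LPSolution V L) (s : Finset V × (Sym2 V → Option L)) :
    PMF (Finset V × (Sym2 V → Option L)) :=
  if h : s.1.Nonempty then
    (drawCluster z h).bind fun q =>
      if (s.1 ∩ q.2).Nonempty then PMF.pure (s.1 \ q.2, paint s.2 (s.1 ∩ q.2) q.1)
      else PMF.pure s
  else PMF.pure s

/-- The output law of cluster-based rounding. -/
def clusterLaw (z : LPSolution V L) (Φ : Sym2 V → Option L) : ℝ≥0∞ :=
  loopLaw (fun s => s.1 = ∅) (clusterBody z) Prod.snd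
    ((Finset.univ : Finset V), fun _ => (none : Option L)) Φ

/-- The expected number of iterations of cluster-based rounding. -/
def clusterIterations (z : LPSolution V L) : ℝ≥0∞ :=
  loopIterations (fun s => s.1 = ∅) (clusterBody z)
    ((Finset.univ : Finset V), fun _ => (none : Option L))

/-! ## Pivot-based rounding -/

/-- The three rounding functions `f⁺, f⁻, f° : [0,1] → [0,1]` (values at reals outside `[0,1]`
are never used). -/
structure Rounding where
  plus : ℝ → unitInterval
  minus : ℝ → unitInterval
  circ : ℝ → unitInterval

/-- Signs of edges with respect to a color `c`. -/
inductive EdgeSign where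
  | plus
  | minus
  | circ

/-- `+` for edges of color `c`, `-` for edges of color `γ`, `∘` for the other edges. -/
def edgeSign (φ : Sym2 V → Option L) (c : L) (e : Sym2 V) : EdgeSign :=
  match φ e with
  | none => .minus
  | some c' => if c' = c then .plus else .circ

/-- `V_c`. -/
def majority (z : L → Finset V → ℝ) (c : L) : Finset V :=
  Finset.univ.filter fun u => xVertex z c u < 1 / 2

/-- `p_{uv}` with respect to the color `c`: the probability that `v` does not join the cluster of
the pivot `u`.  The pivot itself always belongs to its cluster, so `p_{uu} = 0`. -/
def sepProb (φ : Sym2 V → Option L) (z : L → Finset V → ℝ) (f : Rounding) (c : L) (u v : V) :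
    unitInterval :=
  if u = v then 0 else
    match edgeSign φ c s(u, v) with
    | .plus => f.plus (xEdge z c s(u, v))
    | .minus => f.minus (xEdge z c s(u, v))
    | .circ => f.circ (xEdge z c s(u, v))

/-- A coin that shows `true` with probability `p`. -/
def coin (p : unitInterval) : PMF Bool :=
  PMF.ofFintype (fun b => if b then ENNReal.ofReal p else ENNReal.ofReal (1 - p)) (by
    have h : (0 : ℝ) ≤ 1 - p := sub_nonneg.2 p.2.2
    simp [← ENNReal.ofReal_add p.2.1 h])

/-- Go through a list of vertices and add each `v` to `C` independently with probability
`1 - p v`. -/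
def growCluster (p : V → unitInterval) : List V → Finset V → PMF (Finset V)
  | [], C => PMF.pure C
  | v :: l, C =>
    (coin (p v)).bind fun separated => growCluster p l (if separated then C else insert v C)

/-- The current color of the loop `for c ∈ L do while V_c ≠ ∅`: the first color, in a fixed
enumeration of `L`, whose set of remaining vertices is not empty. -/
def currentColor (R : L → Finset V) : Option L :=
  (Finset.univ : Finset L).toList.find? fun c => decide (R c).Nonempty

/-- One iteration of the inner loop; the state consists of the remaining parts of the sets `V_c`
and of `Φ`. -/
def pivotBody (φ : Sym2 V → Option L) (z : L → Finset V → ℝ) (f : Rounding)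
    (s : (L → Finset V) × (Sym2 V → Option L)) : PMF ((L → Finset V) × (Sym2 V → Option L)) :=
  match currentColor s.1 with
  | none => PMF.pure s
  | some c =>
    if h : (s.1 c).Nonempty then
      (PMF.uniformOfFinset (s.1 c) h).bind fun u =>
        (growCluster (sepProb φ z f c u) ((s.1 c).erase u).toList {u}).bind fun C =>
          PMF.pure (Function.update s.1 c (s.1 c \ C), paint s.2 C c)
    else PMF.pure s

/-- The output law of pivot-based rounding. -/
def pivotLaw (φ : Sym2 V → Option L) (z : LPSolution V L) (f : Rounding)
    (Φ : Sym2 V → Option L) : ℝ≥0∞ :=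
  loopLaw (fun s => ∀ c, s.1 c = ∅) (pivotBody φ z.z f) Prod.snd
    (majority z.z, fun _ => (none : Option L)) Φ

/-- The expected number of iterations of pivot-based rounding. -/
def pivotIterations (φ : Sym2 V → Option L) (z : LPSolution V L) (f : Rounding) : ℝ≥0∞ :=
  loopIterations (fun s => ∀ c, s.1 c = ∅) (pivotBody φ z.z f)
    (majority z.z, fun _ => (none : Option L))

/-! ## The mixed algorithm -/

/-- The output law of the mixed algorithm: cluster-based rounding with probability `α / 2`,
pivot-based rounding otherwise. -/
def mixedLaw (α : ℝ) (φ : Sym2 V → Option L) (z : LPSolution V L) (f : Rounding)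
    (Φ : Sym2 V → Option L) : ℝ≥0∞ :=
  ENNReal.ofReal (α / 2) * clusterLaw z Φ + ENNReal.ofReal (1 - α / 2) * pivotLaw φ z f Φ

/-- The expected number of loop iterations of the mixed algorithm. -/
def mixedIterations (α : ℝ) (φ : Sym2 V → Option L) (z : LPSolution V L) (f : Rounding) : ℝ≥0∞ :=
  ENNReal.ofReal (α / 2) * clusterIterations z
    + ENNReal.ofReal (1 - α / 2) * pivotIterations φ z f

/-! ## The triangle inequality -/

/-- `e.cost_w(uv)`: the probability that the edge `uv` is violated, given the pivot `w`.  There is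
no edge, hence no cost, if `u = v`. -/
def eCost (φ : Sym2 V → Option L) (z : L → Finset V → ℝ) (f : Rounding) (c : L) (w u v : V) : ℝ :=
  let puw : ℝ := sepProb φ z f c u w
  let pvw : ℝ := sepProb φ z f c v w
  if u = v then 0 else
    match edgeSign φ c s(u, v) with
    | .plus => puw * (1 - pvw) + (1 - puw) * pvw
    | .minus => (1 - puw) * (1 - pvw)
    | .circ => 1 - puw * pvw

/-- The charging factor `b(uv)`; for `∘` edges it depends on the third vertex `w` as well. -/
def budget (α : ℝ) (φ : Sym2 V → Option L) (z : L → Finset V → ℝ) (c : L) (w u v : V) : ℝ :=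
  let x := xEdge z c s(u, v)
  let m := max (max (1 / 2) (1 - x)) (max (1 - xEdge z c s(v, w)) (1 - xEdge z c s(w, u)))
  α / (1 - α / 2) *
    match edgeSign φ c s(u, v) with
    | .plus => x ^ 2 / (1 + x)
    | .minus => (1 + 2 * x) * (1 - x) / (2 * (1 + x))
    | .circ => m ^ 2 / (1 + m)

/-- `e.lp_w(uv)`: the probability that `u` or `v` is in the cluster of the pivot `w`, multiplied
by the charging factor; again `0` if `u = v`. -/
def eLp (α : ℝ) (φ : Sym2 V → Option L) (z : L → Finset V → ℝ) (f : Rounding) (c : L)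
    (w u v : V) : ℝ :=
  if u = v then 0 else
    (1 - (sepProb φ z f c u w : ℝ) * (sepProb φ z f c v w : ℝ)) * budget α φ z c w u v

/-- `ALG(uvw)`. -/
def ALG (φ : Sym2 V → Option L) (z : L → Finset V → ℝ) (f : Rounding) (c : L) (u v w : V) : ℝ :=
  eCost φ z f c w u v + eCost φ z f c u v w + eCost φ z f c v w u

/-- `LP(uvw)`. -/
def LP (α : ℝ) (φ : Sym2 V → Option L) (z : L → Finset V → ℝ) (f : Rounding) (c : L)
    (u v w : V) : ℝ :=
  eLp α φ z f c w u v + eLp α φ z f c u v w + eLp α φ z f c v w u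

end CCC

end

/-!
Both roundings are while loops with a random body, and both parts of the claim about such a loop
come from one function of its state. A nonnegative function that drops by at least `1` in
expectation in each iteration bounds the expected number of iterations (`loopIterations_le`), which
also gives termination (`sum_loopLaw_eq_one`). A nonnegative function that does not grow in
expectation and dominates the cost in the halted states bounds the expected cost of the output
(`expect_output_le`). For the cost this function is a sum over the edges (`potential`): an edge
whose end points may still be put into a common cluster counts with a bound fixed in advance, any
other edge counts `1` if it is violated.

*Cluster-based rounding.* With `y` the total mass of the sets containing an edge, the sets that meet
the edge have mass `2 - y`. Hence an edge of color `c` is violated with probability at most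
`2 x / (1 + x)`, where `x = x_e^c`, and an edge of color `γ` with probability at most
`y / (2 - y)` (`expect_potential_clusterBody_le`).

*Pivot-based rounding.* Each vertex lies in at most one set `V_c`, since it has more than half of its
mass in the color `c`. In one iteration for the color `c` the triangle inequality, summed over all
triples of remaining vertices of `V_c`, says that the expected cost of the edges decided in this
iteration is at most the expected sum of their charging factors (`sum_eCost_le_sum_eLp`). The
charging factors depend on the color and on the pivot, but they are at most a number that depends on
the edge only (`budget_le_pivotBound`), so the charges can be collected over all iterations
(`expect_potential_pivotBody_le`).

*Mixture.* The last number is chosen such that `α / 2` times the bound for cluster-based rounding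
plus `1 - α / 2` times the bound for pivot-based rounding is `α` times the contribution of the edge
to the LP objective. The end points of an edge that lies inside none of the sets `V_c` are always
separated by pivot-based rounding; for such edges `α ≥ 3/2` suffices (`mixed_bound_le`).
Summing over the edges, the expected cost is at most `α · obj(z)`.
-/

set_option linter.unusedSectionVars false

namespace CCC

/-! ### Expectations over finite probability spaces -/

/-- The expectation of a real function under a probability mass function on a finite type. -/
noncomputable def expect {σ : Type*} [Fintype σ] (p : PMF σ) (g : σ → ℝ) : ℝ :=
  ∑ a, (p a).toReal * g a

section Expect

variable {σ τ : Type*} [Fintype σ] [Fintype τ]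

theorem expect_pure (a : σ) (g : σ → ℝ) : expect (PMF.pure a) g = g a := by
  classical
  simp only [expect, PMF.pure_apply]
  rw [Finset.sum_eq_single a] <;> simp +contextual

theorem expect_bind (p : PMF σ) (f : σ → PMF τ) (g : τ → ℝ) :
    expect (p.bind f) g = expect p fun a => expect (f a) g := by
  have h : ∀ b, (p.bind f b).toReal = ∑ a, (p a).toReal * (f a b).toReal := by
    intro b
    rw [PMF.bind_apply, tsum_fintype, ENNReal.toReal_sum]
    · simp [ENNReal.toReal_mul]
    · exact fun a _ => ENNReal.mul_ne_top (p.apply_ne_top a) ((f a).apply_ne_top b)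
  simp only [expect, h, Finset.sum_mul, Finset.mul_sum, mul_assoc]
  exact Finset.sum_comm

theorem expect_const (p : PMF σ) (r : ℝ) : expect p (fun _ => r) = r := by
  have h : ∑ a, (p a).toReal = 1 := by
    rw [← ENNReal.toReal_sum fun a _ => p.apply_ne_top a, ← tsum_fintype (L := .unconditional σ),
      p.tsum_coe, ENNReal.toReal_one]
  simp [expect, ← Finset.sum_mul, h]

theorem expect_mono (p : PMF σ) {g h : σ → ℝ} (hgh : ∀ a ∈ p.support, g a ≤ h a) :
    expect p g ≤ expect p h := by
  refine Finset.sum_le_sum fun a _ => ?_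
  by_cases ha : a ∈ p.support
  · exact mul_le_mul_of_nonneg_left (hgh a ha) ENNReal.toReal_nonneg
  · simp [(PMF.apply_eq_zero_iff p a).2 ha]

theorem expect_congr (p : PMF σ) {g h : σ → ℝ} (hgh : ∀ a ∈ p.support, g a = h a) :
    expect p g = expect p h :=
  le_antisymm (expect_mono p fun a ha => (hgh a ha).le)
    (expect_mono p fun a ha => (hgh a ha).ge)

theorem expect_sum {ι : Type*} (p : PMF σ) (s : Finset ι) (g : ι → σ → ℝ) :
    expect p (fun a => ∑ i ∈ s, g i a) = ∑ i ∈ s, expect p (g i) := by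
  simp only [expect, Finset.mul_sum]
  exact Finset.sum_comm

theorem expect_add (p : PMF σ) (g h : σ → ℝ) :
    expect p (fun a => g a + h a) = expect p g + expect p h := by
  simp [expect, mul_add, Finset.sum_add_distrib]

theorem expect_mul_const (p : PMF σ) (g : σ → ℝ) (r : ℝ) :
    expect p (fun a => g a * r) = expect p g * r := by
  simp [expect, Finset.sum_mul, mul_assoc]

theorem expect_const_mul (p : PMF σ) (g : σ → ℝ) (r : ℝ) :
    expect p (fun a => r * g a) = r * expect p g := by
  simp only [mul_comm r, expect_mul_const]

theorem toOuterMeasure_toReal (p : PMF σ) (A : Set σ) :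
    (p.toOuterMeasure A).toReal = expect p (A.indicator 1) := by
  classical
  rw [PMF.toOuterMeasure_apply_fintype, ENNReal.toReal_sum]
  · refine Finset.sum_congr rfl fun a _ => ?_
    by_cases ha : a ∈ A <;> simp [ha]
  · intro a _
    by_cases ha : a ∈ A <;> simp [ha, p.apply_ne_top a]

end Expect

theorem toOuterMeasure_le_one {σ : Type*} (p : PMF σ) (A : Set σ) : p.toOuterMeasure A ≤ 1 := by
  rw [PMF.toOuterMeasure_apply, ← p.tsum_coe]
  exact ENNReal.tsum_le_tsum fun a => Set.indicator_le_self _ _ a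

/-! ### While loops: invariants, drift and expected output -/

section Loop

variable {σ β : Type*} (halted : σ → Prop) [DecidablePred halted] (body : σ → PMF σ)

theorem loopRun_of_halted {s : σ} (hs : halted s) (k : ℕ) :
    loopRun halted body k s = PMF.pure s := by
  cases k <;> simp [loopRun, hs]

theorem loopRun_succ_of_not_halted {s : σ} (hs : ¬ halted s) (k : ℕ) :
    loopRun halted body (k + 1) s = (body s).bind (loopRun halted body k) := by
  simp [loopRun, hs]

variable {halted body} {I : σ → Prop}

theorem loopRun_invariant (hI : ∀ s, I s → ¬ halted s → ∀ t ∈ (body s).support, I t) :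
    ∀ k s, I s → ∀ t ∈ (loopRun halted body k s).support, I t := by
  intro k
  induction k with
  | zero => intro s hs t ht; simp only [loopRun, PMF.support_pure, Set.mem_singleton_iff] at ht
            exact ht ▸ hs
  | succ k ih =>
    intro s hs t ht
    by_cases h : halted s
    · rw [loopRun_of_halted _ _ h] at ht
      simp only [PMF.support_pure, Set.mem_singleton_iff] at ht
      exact ht ▸ hs
    · rw [loopRun_succ_of_not_halted _ _ h, PMF.mem_support_bind_iff] at ht
      obtain ⟨r, hr, ht⟩ := ht
      exact ih r (hI s hs h r hr) t ht

theorem exists_of_loopLaw_ne_zero (hI : ∀ s, I s → ¬ halted s → ∀ t ∈ (body s).support, I t)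
    (output : σ → β) {s : σ} (hs : I s) {b : β} (hb : loopLaw halted body output s b ≠ 0) :
    ∃ t, I t ∧ halted t ∧ output t = b := by
  simp only [loopLaw, ne_eq, ENNReal.iSup_eq_zero, not_forall] at hb
  obtain ⟨k, hk⟩ := hb
  rw [PMF.toOuterMeasure_apply_eq_zero_iff, Set.not_disjoint_iff] at hk
  obtain ⟨t, ht, h1, h2⟩ := hk
  exact ⟨t, loopRun_invariant hI k s hs t ht, h1, h2⟩

theorem loopLaw_ne_top (output : σ → β) (s : σ) (b : β) :
    loopLaw halted body output s b ≠ ∞ :=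
  ne_top_of_le_ne_top ENNReal.one_ne_top (iSup_le fun _ => toOuterMeasure_le_one _ _)

variable [Fintype σ]

/-- A function that does not grow in expectation during one iteration (a supermartingale) does not
grow in expectation during any number of iterations. -/
theorem expect_loopRun_le (hI : ∀ s, I s → ¬ halted s → ∀ t ∈ (body s).support, I t)
    {U : σ → ℝ} (hU : ∀ s, I s → ¬ halted s → expect (body s) U ≤ U s) :
    ∀ k s, I s → expect (loopRun halted body k s) U ≤ U s := by
  intro k
  induction k with
  | zero => intro s _; rw [loopRun, expect_pure]
  | succ k ih =>
    intro s hs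
    by_cases h : halted s
    · rw [loopRun_of_halted _ _ h, expect_pure]
    · rw [loopRun_succ_of_not_halted _ _ h, expect_bind]
      exact (expect_mono _ fun t ht => ih t (hI s hs h t ht)).trans (hU s hs h)

/-- Additive drift: if `W ≥ 0` decreases by at least `1` in expectation during every iteration,
then the expected number of iterations is at most the initial value of `W`. -/
theorem loopIterations_le (hI : ∀ s, I s → ¬ halted s → ∀ t ∈ (body s).support, I t)
    {W : σ → ℝ} (hW0 : ∀ s, 0 ≤ W s)
    (hW : ∀ s, I s → ¬ halted s → expect (body s) W + 1 ≤ W s) {s : σ} (hs : I s) :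
    loopIterations halted body s ≤ ENNReal.ofReal (W s) := by
  have key : ∀ n s, I s → ∑ k ∈ Finset.range n,
      expect (loopRun halted body k s) ({t | ¬ halted t}.indicator 1) ≤ W s := by
    intro n
    induction n with
    | zero => intro s _; simpa using hW0 s
    | succ n ih =>
      intro s hs
      by_cases h : halted s
      · simp [loopRun_of_halted _ _ h, expect_pure, h, hW0 s]
      · rw [Finset.sum_range_succ']
        simp only [loopRun_succ_of_not_halted _ _ h, expect_bind]
        rw [← expect_sum, loopRun, expect_pure, Set.indicator_of_mem (by simpa using h)]
        refine le_trans ?_ (hW s hs h)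
        simp only [Pi.one_apply]
        gcongr
        exact expect_mono _ fun t ht => ih t (hI s hs h t ht)
  refine ENNReal.tsum_le_of_sum_range_le fun n => ?_
  refine le_trans (le_of_eq ?_) (ENNReal.ofReal_le_ofReal (key n s hs))
  rw [ENNReal.ofReal_sum_of_nonneg]
  · refine Finset.sum_congr rfl fun k _ => ?_
    rw [← toOuterMeasure_toReal, ENNReal.ofReal_toReal]
    exact ne_top_of_le_ne_top ENNReal.one_ne_top (toOuterMeasure_le_one _ _)
  · intro k _
    rw [← toOuterMeasure_toReal]
    exact ENNReal.toReal_nonneg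

theorem expect_loopRun_mono {g : σ → ℝ} (hg : ∀ t, 0 ≤ g t) (hg' : ∀ t, ¬ halted t → g t = 0) :
    ∀ k s, expect (loopRun halted body k s) g ≤ expect (loopRun halted body (k + 1) s) g := by
  intro k
  induction k with
  | zero =>
    intro s
    by_cases h : halted s
    · simp [loopRun_of_halted _ _ h]
    · rw [loopRun, expect_pure, hg' s h]
      exact Finset.sum_nonneg fun t _ => mul_nonneg ENNReal.toReal_nonneg (hg t)
  | succ k ih =>
    intro s
    by_cases h : halted s
    · simp [loopRun_of_halted _ _ h]
    · simp only [loopRun_succ_of_not_halted _ _ h, expect_bind]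
      exact expect_mono _ fun t _ => ih t

theorem tendsto_loopLaw (output : σ → β) (s : σ) (b : β) :
    Filter.Tendsto (fun k => expect (loopRun halted body k s)
      ({t | halted t ∧ output t = b}.indicator 1)) Filter.atTop
      (nhds (loopLaw halted body output s b).toReal) := by
  have hmono : Monotone fun k =>
      (loopRun halted body k s).toOuterMeasure {t | halted t ∧ output t = b} := by
    refine monotone_nat_of_le_succ fun k => ?_
    rw [← ENNReal.toReal_le_toReal, toOuterMeasure_toReal, toOuterMeasure_toReal]
    · exact expect_loopRun_mono (fun t => Set.indicator_nonneg (by simp) t)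
        (fun t ht => Set.indicator_of_notMem (fun h => ht h.1) _) k s
    all_goals exact ne_top_of_le_ne_top ENNReal.one_ne_top (toOuterMeasure_le_one _ _)
  have h := (ENNReal.tendsto_toReal (loopLaw_ne_top (halted := halted) (body := body)
    output s b)).comp (tendsto_atTop_iSup hmono)
  simpa only [Function.comp_def, toOuterMeasure_toReal] using h

variable [Fintype β]

theorem tendsto_expect_output (output : σ → β) (s : σ) (F : β → ℝ) :
    Filter.Tendsto (fun k => expect (loopRun halted body k s)
      fun t => if halted t then F (output t) else 0) Filter.atTop
      (nhds (∑ b, (loopLaw halted body output s b).toReal * F b)) := by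
  classical
  refine (tendsto_finsetSum Finset.univ fun b _ =>
    (tendsto_loopLaw output s b).mul_const (F b)).congr fun k => ?_
  simp only [← expect_mul_const]
  rw [← expect_sum]
  refine expect_congr _ fun t _ => ?_
  by_cases h : halted t <;> simp [h, Set.indicator_apply]

/-- A loop whose expected number of iterations is finite terminates almost surely. -/
theorem sum_loopLaw_eq_one (output : σ → β) {s : σ} (h : loopIterations halted body s ≠ ∞) :
    ∑ b, loopLaw halted body output s b = 1 := by
  have h0 := (ENNReal.tendsto_toReal ENNReal.zero_ne_top).comp
    (ENNReal.tendsto_atTop_zero_of_tsum_ne_top h)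
  have h1 := tendsto_expect_output (halted := halted) (body := body) output s fun _ => 1
  have h2 := h1.add h0
  have h3 : ∀ k, (expect (loopRun halted body k s) fun t => if halted t then (1 : ℝ) else 0)
      + ((loopRun halted body k s).toOuterMeasure {t | ¬ halted t}).toReal = 1 := by
    intro k
    rw [toOuterMeasure_toReal, ← expect_add, ← expect_const (loopRun halted body k s) 1]
    refine expect_congr _ fun t _ => ?_
    by_cases h : halted t <;> simp [h, expect_const]
  have h4 := tendsto_nhds_unique (h2.congr h3) tendsto_const_nhds
  simp only [mul_one, ENNReal.toReal_zero, add_zero] at h4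
  rw [← ENNReal.toReal_sum fun b _ => loopLaw_ne_top _ _ _] at h4
  exact (ENNReal.toReal_eq_one_iff _).1 h4

/-- The expected cost of the output is at most the initial value of any nonnegative supermartingale
that dominates the cost in the halted states. -/
theorem expect_output_le (hI : ∀ s, I s → ¬ halted s → ∀ t ∈ (body s).support, I t)
    {U : σ → ℝ} (hU0 : ∀ s, 0 ≤ U s) (hU : ∀ s, I s → ¬ halted s → expect (body s) U ≤ U s)
    (output : σ → β) (F : β → ℝ) (hF : ∀ s, halted s → F (output s) ≤ U s) {s : σ} (hs : I s) :
    ∑ b, (loopLaw halted body output s b).toReal * F b ≤ U s := by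
  refine le_of_tendsto' (tendsto_expect_output output s F) fun k => ?_
  refine le_trans (expect_mono _ fun t _ => ?_) (expect_loopRun_le hI hU k s hs)
  split_ifs with h
  · exact hF t h
  · exact hU0 t

end Loop

variable {V L : Type*} [Fintype V] [DecidableEq V] [Fintype L] [DecidableEq L]

/-! ### The masses of a feasible solution -/

section Mass

variable (z : LPSolution V L)

theorem weight_toReal (q : L × Finset V) :
    (weight z.z q).toReal = if q.2.Nonempty then z.z q.1 q.2 else 0 := by
  unfold weight
  split_ifs with h
  · exact ENNReal.toReal_ofReal (z.nonneg _ _ h)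
  · simp

theorem one_sub_xVertex_eq (c : L) (u : V) :
    1 - xVertex z.z c u = 1 - xEdge z.z c s(u, u) := by
  simp [xVertex, xEdge]

theorem one_sub_xEdge_nonneg (c : L) (u v : V) : 0 ≤ 1 - xEdge z.z c s(u, v) := by
  rw [xEdge, sub_sub_cancel]
  refine Finset.sum_nonneg fun S hS => z.nonneg c S ⟨u, ?_⟩
  simp only [Finset.mem_filter] at hS
  exact hS.2 u (by simp)

theorem one_sub_xVertex_nonneg (c : L) (u : V) : 0 ≤ 1 - xVertex z.z c u := by
  rw [one_sub_xVertex_eq]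
  exact one_sub_xEdge_nonneg z c u u

theorem xVertex_le_xEdge_left (c : L) (u v : V) : xVertex z.z c u ≤ xEdge z.z c s(u, v) := by
  rw [xEdge, xVertex]
  refine sub_le_sub_left (Finset.sum_le_sum_of_subset_of_nonneg ?_ ?_) 1
  · intro S hS
    simp only [Finset.mem_filter, Sym2.mem_iff] at hS ⊢
    exact ⟨hS.1, hS.2 u (by simp)⟩
  · intro S hS _
    simp only [Finset.mem_filter] at hS
    exact z.nonneg c S ⟨u, hS.2⟩

theorem xVertex_le_xEdge_right (c : L) (u v : V) : xVertex z.z c v ≤ xEdge z.z c s(u, v) := by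
  rw [Sym2.eq_swap]
  exact xVertex_le_xEdge_left z c v u

theorem one_sub_xVertex_add_le_one {c c' : L} (h : c ≠ c') (u : V) :
    (1 - xVertex z.z c u) + (1 - xVertex z.z c' u) ≤ 1 := by
  refine le_trans ?_ (z.normalized u).le
  rw [← Finset.sum_pair (f := fun c => 1 - xVertex z.z c u) h]
  exact Finset.sum_le_sum_of_subset_of_nonneg (Finset.subset_univ _)
    fun i _ _ => one_sub_xVertex_nonneg z i u

theorem xVertex_nonneg (c : L) (u : V) : 0 ≤ xVertex z.z c u := by
  have h := Finset.single_le_sum (f := fun c => 1 - xVertex z.z c u)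
    (fun i _ => one_sub_xVertex_nonneg z i u) (Finset.mem_univ c)
  rw [z.normalized u] at h
  simpa using h

theorem xEdge_nonneg (c : L) (u v : V) : 0 ≤ xEdge z.z c s(u, v) :=
  (xVertex_nonneg z c u).trans (xVertex_le_xEdge_left z c u v)

theorem xEdge_le_one (c : L) (u v : V) : xEdge z.z c s(u, v) ≤ 1 :=
  sub_nonneg.1 (one_sub_xEdge_nonneg z c u v)

/-- The total mass `∑_c (1 - x_e^c)` of the sets that contain the edge `e`. -/
noncomputable def joinMass (e : Sym2 V) : ℝ := ∑ c, (1 - xEdge z.z c e)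

theorem one_sub_xEdge_le_joinMass (c : L) (u v : V) :
    1 - xEdge z.z c s(u, v) ≤ joinMass z s(u, v) :=
  Finset.single_le_sum (f := fun c => 1 - xEdge z.z c s(u, v))
    (fun i _ => one_sub_xEdge_nonneg z i u v) (Finset.mem_univ c)

theorem joinMass_nonneg (u v : V) : 0 ≤ joinMass z s(u, v) :=
  Finset.sum_nonneg fun c _ => one_sub_xEdge_nonneg z c u v

theorem joinMass_le_one (u v : V) : joinMass z s(u, v) ≤ 1 := by
  rw [← z.normalized u]
  exact Finset.sum_le_sum fun c _ => sub_le_sub_left (xVertex_le_xEdge_left z c u v) 1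

/-- A vertex has more than half of its mass in at most one color. -/
theorem eq_of_mem_majority {c c' : L} {u : V} (h : u ∈ majority z.z c)
    (h' : u ∈ majority z.z c') : c = c' := by
  by_contra hne
  simp only [majority, Finset.mem_filter] at h h'
  linarith [one_sub_xVertex_add_le_one z hne u]

/-- The total mass `∑_{c, S ≠ ∅} z_S^c`. -/
noncomputable def totalMass : ℝ := ∑ q, (weight z.z q).toReal

theorem sum_weight_edge_color (c : L) (u v : V) :
    ∑ q, (weight z.z q).toReal * (if q.1 = c ∧ u ∈ q.2 ∧ v ∈ q.2 then 1 else 0)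
      = 1 - xEdge z.z c s(u, v) := by
  rw [Fintype.sum_prod_type, Finset.sum_eq_single c]
  · rw [xEdge, sub_sub_cancel, Finset.sum_filter]
    refine Finset.sum_congr rfl fun S _ => ?_
    rw [weight_toReal]
    by_cases h : u ∈ S ∧ v ∈ S
    · have hne : S.Nonempty := ⟨u, h.1⟩
      simp [h, hne]
    · simp [h]
  · intro c' _ hc'
    simp [hc']
  · simp

theorem sum_weight_edge (u v : V) :
    ∑ q, (weight z.z q).toReal * (if u ∈ q.2 ∧ v ∈ q.2 then 1 else 0) = joinMass z s(u, v) := by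
  simp only [joinMass, ← sum_weight_edge_color]
  rw [Finset.sum_comm]
  refine Finset.sum_congr rfl fun q _ => ?_
  rw [← Finset.mul_sum]
  congr 1
  by_cases h : u ∈ q.2 ∧ v ∈ q.2 <;> simp [h]

theorem sum_weight_vertex (u : V) :
    ∑ q, (weight z.z q).toReal * (if u ∈ q.2 then 1 else 0) = 1 := by
  have h := sum_weight_edge z u u
  simp only [and_self, joinMass, ← one_sub_xVertex_eq, z.normalized u] at h
  exact h

theorem totalMass_le_card : totalMass z ≤ Fintype.card V := by
  have h : ∑ u : V, ∑ q, (weight z.z q).toReal * (if u ∈ q.2 then 1 else 0)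
      = (Fintype.card V : ℝ) := by
    simp [sum_weight_vertex, -mul_ite]
  rw [← h, Finset.sum_comm]
  refine Finset.sum_le_sum fun q _ => ?_
  by_cases hq : q.2.Nonempty
  · obtain ⟨u, hu⟩ := hq
    refine le_trans (by simp [hu]) (Finset.single_le_sum (f := fun u =>
      (weight z.z q).toReal * (if u ∈ q.2 then 1 else 0)) (fun i _ => ?_) (Finset.mem_univ u))
    split_ifs <;> simp
  · rw [weight_toReal, if_neg hq]
    simp

theorem totalMass_pos (u : V) : 0 < totalMass z := by
  refine zero_lt_one.trans_le ((sum_weight_vertex z u).symm.le.trans ?_)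
  refine Finset.sum_le_sum fun q _ => ?_
  split_ifs <;> simp

theorem totalMass_nonneg : 0 ≤ totalMass z :=
  Finset.sum_nonneg fun _ _ => ENNReal.toReal_nonneg

theorem expect_drawCluster {R : Finset V} (hR : R.Nonempty) (g : L × Finset V → ℝ) :
    expect (drawCluster z hR) g = (∑ q, (weight z.z q).toReal * g q) / totalMass z := by
  simp only [expect, drawCluster, PMF.normalize_apply, ENNReal.toReal_mul, ENNReal.toReal_inv,
    tsum_fintype]
  rw [ENNReal.toReal_sum, Finset.sum_div, ← totalMass]
  · refine Finset.sum_congr rfl fun q _ => ?_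
    ring
  · intro q _
    unfold weight
    split_ifs <;> simp

end Mass

/-! ### Disagreements and partial clusterings -/

/-- The contribution of the edge `e` to the cost. -/
noncomputable def disagreement (φ Φ : Sym2 V → Option L) (e : Sym2 V) : ℝ :=
  if Φ e = φ e then 0 else 1

theorem disagreement_nonneg (φ Φ : Sym2 V → Option L) (e : Sym2 V) :
    0 ≤ disagreement φ Φ e := by
  unfold disagreement
  split_ifs <;> simp

theorem cost_eq_sum (φ Φ : Sym2 V → Option L) :
    (cost φ Φ : ℝ) = ∑ e ∈ edges V, disagreement φ Φ e := by
  simp only [cost, disagreement, Finset.card_filter, Nat.cast_add, Nat.cast_sum,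
    ← Finset.sum_add_distrib]
  refine Finset.sum_congr rfl fun e _ => ?_
  cases h : φ e <;> by_cases h' : Φ e = φ e <;> simp_all

theorem mk_mem_edges {u v : V} : s(u, v) ∈ edges V ↔ u ≠ v := by
  simp [edges]

/-- A state of the roundings: `Φ` is the function on pairs of a clustering in which the vertices of
`R` (those still to be clustered) are singletons. The clustering is given by a representative
`κ u` of the cluster of `u` and by a color of each representative. -/
def PartialClustering (R : Set V) (Φ : Sym2 V → Option L) : Prop :=
  ∃ (κ : V → V) (col : V → L),
    (∀ u v, u ≠ v → Φ s(u, v) = if κ u = κ v then some (col (κ u)) else none) ∧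
    ∀ a ∈ R, κ a = a ∧ ∀ b, κ b = a → b = a

theorem PartialClustering.init (z : LPSolution V L) (R : Set V) :
    PartialClustering R fun _ : Sym2 V => (none : Option L) := by
  have hL : V → Nonempty L := by
    intro u
    by_contra h
    rw [not_nonempty_iff] at h
    simpa using z.normalized u
  exact ⟨id, fun u => (hL u).some, by simp +contextual, by simp⟩

theorem PartialClustering.apply_eq_none {R : Set V} {Φ : Sym2 V → Option L}
    (h : PartialClustering R Φ) {u v : V} (huv : u ≠ v) (hu : u ∈ R) : Φ s(u, v) = none := by
  obtain ⟨κ, col, h1, h2⟩ := h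
  rw [h1 u v huv, if_neg]
  intro hκ
  rw [(h2 u hu).1] at hκ
  exact huv ((h2 u hu).2 v hκ.symm).symm

theorem PartialClustering.paint {R R' : Set V} {Φ : Sym2 V → Option L}
    (h : PartialClustering R Φ) {C : Finset V} (hne : C.Nonempty) (hC : ∀ a ∈ C, a ∈ R)
    (hR' : ∀ a ∈ R', a ∈ R ∧ a ∉ C) (c : L) : PartialClustering R' (paint Φ C c) := by
  obtain ⟨κ, col, h1, h2⟩ := h
  obtain ⟨w, hw⟩ := hne
  have hκ : ∀ b, b ∉ C → κ b ≠ w := fun b hb he =>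
    hb (((h2 w (hC w hw)).2 b he).symm ▸ hw)
  refine ⟨fun u => if u ∈ C then w else κ u, Function.update col w c, ?_, ?_⟩
  · intro u v huv
    simp only [CCC.paint, Sym2.mem_iff, forall_eq_or_imp, forall_eq]
    by_cases hu : u ∈ C <;> by_cases hv : v ∈ C
    · simp [hu, hv]
    · simp [hu, hv, h1 u v huv, (hκ v hv).symm, (h2 u (hC u hu)).1]
      exact fun he => huv ((h2 u (hC u hu)).2 v he.symm).symm
    · simp [hu, hv, h1 u v huv, hκ u hu, (h2 v (hC v hv)).1]
      exact fun he => huv ((h2 v (hC v hv)).2 u he)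
    · simp [hu, hv, h1 u v huv, hκ u hu]
  · intro a ha
    obtain ⟨haR, haC⟩ := hR' a ha
    refine ⟨by simp [haC, (h2 a haR).1], fun b hb => ?_⟩
    by_cases hbC : b ∈ C
    · simp only [hbC, if_true] at hb
      exact absurd hw (hb ▸ haC)
    · simp only [hbC, if_false] at hb
      exact (h2 a haR).2 b hb

theorem PartialClustering.isClustering {R : Set V} {Φ : Sym2 V → Option L}
    (h : PartialClustering R Φ) : IsClustering Φ := by
  obtain ⟨κ, col, h1, -⟩ := h
  refine ⟨⟨Setoid.ker κ, Quotient.lift (fun u => col (κ u)) fun a b hab => congrArg col hab⟩, ?_⟩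
  intro e
  induction e with | _ u v
  intro he
  rw [h1 u v (mk_mem_edges.1 he)]
  simp only [ChromaticClustering.label, Sym2.lift_mk, Setoid.ker_def, Quotient.lift_mk]

open Classical in
/-- The potential of a state: an edge inside the part that is still to be clustered (`live`) counts
with its bound `Q`, every other edge counts `1` if it is violated. -/
noncomputable def potential (φ : Sym2 V → Option L) (Q : Sym2 V → ℝ) (live : Sym2 V → Prop)
    (Φ : Sym2 V → Option L) (e : Sym2 V) : ℝ :=
  if live e then Q e else disagreement φ Φ e

theorem potential_nonneg {φ : Sym2 V → Option L} {Q : Sym2 V → ℝ} (hQ : ∀ e, 0 ≤ Q e)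
    (live : Sym2 V → Prop) (Φ : Sym2 V → Option L) (e : Sym2 V) :
    0 ≤ potential φ Q live Φ e := by
  unfold potential
  split_ifs
  exacts [hQ e, disagreement_nonneg φ Φ e]

/-! ### Cluster-based rounding -/

section Cluster

variable (z : LPSolution V L)

theorem clusterBody_eq {s : Finset V × (Sym2 V → Option L)} (h : s.1.Nonempty) :
    clusterBody z s = (drawCluster z h).bind fun q =>
      PMF.pure (if (s.1 ∩ q.2).Nonempty then (s.1 \ q.2, paint s.2 (s.1 ∩ q.2) q.1) else s) := by
  simp only [clusterBody, h, dif_pos]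
  congr 1
  funext q
  split_ifs <;> rfl

theorem clusterBody_invariant (s : Finset V × (Sym2 V → Option L))
    (hs : PartialClustering (s.1 : Set V) s.2) (hh : ¬ s.1 = ∅) :
    ∀ t ∈ (clusterBody z s).support, PartialClustering (t.1 : Set V) t.2 := by
  intro t ht
  rw [clusterBody_eq z (Finset.nonempty_iff_ne_empty.2 hh)] at ht
  simp only [PMF.mem_support_bind_iff, PMF.support_pure, Set.mem_singleton_iff] at ht
  obtain ⟨q, -, rfl⟩ := ht
  split_ifs with h
  · refine hs.paint h ?_ ?_ q.1 <;> simp +contextual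
  · exact hs

theorem expect_clusterBody {s : Finset V × (Sym2 V → Option L)} (h : s.1.Nonempty)
    (g : Finset V × (Sym2 V → Option L) → ℝ) :
    expect (clusterBody z s) g = (∑ q, (weight z.z q).toReal *
      g (if (s.1 ∩ q.2).Nonempty then (s.1 \ q.2, paint s.2 (s.1 ∩ q.2) q.1) else s))
        / totalMass z := by
  simp only [clusterBody_eq z h, expect_bind, expect_pure, expect_drawCluster]

/-- Every remaining vertex is covered with probability `1 / totalMass` in every iteration. -/
theorem clusterIterations_le : clusterIterations z ≤ (Fintype.card V : ℝ≥0∞) ^ 2 := by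
  have h := loopIterations_le (halted := fun s : Finset V × (Sym2 V → Option L) => s.1 = ∅)
    (I := fun s => PartialClustering (s.1 : Set V) s.2)
    (clusterBody_invariant z) (W := fun s => totalMass z * (s.1.card : ℝ))
    (fun s => mul_nonneg (totalMass_nonneg z) (Nat.cast_nonneg _)) ?_
    (s := (Finset.univ, fun _ => none)) (PartialClustering.init z _)
  · refine h.trans ?_
    rw [← ENNReal.ofReal_natCast, ← ENNReal.ofReal_pow (Nat.cast_nonneg _), sq]
    refine ENNReal.ofReal_le_ofReal ?_
    rw [Finset.card_univ]
    exact mul_le_mul_of_nonneg_right (totalMass_le_card z) (Nat.cast_nonneg _)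
  · intro s _ hh
    have hne : s.1.Nonempty := Finset.nonempty_iff_ne_empty.2 hh
    have hZ := totalMass_pos z hne.choose
    have h1 : ∀ q : L × Finset V,
        (((if (s.1 ∩ q.2).Nonempty then (s.1 \ q.2, paint s.2 (s.1 ∩ q.2) q.1) else s).1.card : ℕ)
          : ℝ) = s.1.card - ∑ u ∈ s.1, if u ∈ q.2 then 1 else 0 := by
      intro q
      have h2 : (if (s.1 ∩ q.2).Nonempty then (s.1 \ q.2, paint s.2 (s.1 ∩ q.2) q.1)
          else s).1 = s.1 \ q.2 := by
        split_ifs with hq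
        · rfl
        · rw [Finset.not_nonempty_iff_eq_empty, ← Finset.disjoint_iff_inter_eq_empty] at hq
          exact (Finset.sdiff_eq_self_of_disjoint hq).symm
      rw [h2, eq_sub_iff_add_eq, Finset.sum_boole, Finset.filter_mem_eq_inter]
      exact_mod_cast Finset.card_sdiff_add_card_inter s.1 q.2
    rw [expect_const_mul, expect_clusterBody z hne]
    simp only [h1, mul_sub, Finset.sum_sub_distrib, Finset.mul_sum]
    rw [Finset.sum_comm (s := Finset.univ) (t := s.1), ← Finset.sum_mul, ← totalMass]
    simp only [sum_weight_vertex]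
    have hc : (1 : ℝ) ≤ s.1.card := by exact_mod_cast hne.card_pos
    rw [mul_div_cancel₀ _ hZ.ne']
    simp only [Finset.sum_const, nsmul_eq_mul, mul_one]
    linarith

/-- A bound on the probability that cluster-based rounding violates the edge `e`. -/
noncomputable def clusterBound (φ : Sym2 V → Option L) (e : Sym2 V) : ℝ :=
  match φ e with
  | some c => 2 * xEdge z.z c e / (1 + xEdge z.z c e)
  | none => joinMass z e / (2 - joinMass z e)

theorem clusterBound_nonneg (φ : Sym2 V → Option L) (e : Sym2 V) : 0 ≤ clusterBound z φ e := by
  induction e with | _ u v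
  unfold clusterBound
  split
  · next c _ =>
    have := xEdge_nonneg z c u v
    positivity
  · exact div_nonneg (joinMass_nonneg z u v) (by linarith [joinMass_le_one z u v])

/-- One draw of a pair `(c, S)` splits, joins or misses the edge `uv`; the sets that meet the edge
have total mass `2 - joinMass`. -/
theorem expect_potential_clusterBody_le (φ : Sym2 V → Option L)
    {s : Finset V × (Sym2 V → Option L)} (hs : PartialClustering (s.1 : Set V) s.2)
    (hne : s.1.Nonempty) {e : Sym2 V} (he : e ∈ edges V) :
    expect (clusterBody z s)
        (fun t => potential φ (clusterBound z φ) (fun e => ∀ a ∈ e, a ∈ t.1) t.2 e)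
      ≤ potential φ (clusterBound z φ) (fun e => ∀ a ∈ e, a ∈ s.1) s.2 e := by
  induction e with | _ u v
  have huv : u ≠ v := mk_mem_edges.1 he
  by_cases hlive : u ∈ s.1 ∧ v ∈ s.1
  · have hZ := totalMass_pos z u
    rw [expect_clusterBody z hne, div_le_iff₀ hZ]
    set Q := clusterBound z φ s(u, v) with hQ
    have hnone := hs.apply_eq_none huv (by simpa using hlive.1)
    -- the new potential of `uv`, as a linear combination of indicators of the drawn pair
    have hstep : ∀ q : L × Finset V, (fun t : Finset V × (Sym2 V → Option L) =>
        potential φ (clusterBound z φ) (fun e => ∀ a ∈ e, a ∈ t.1) t.2 s(u, v))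
        (if (s.1 ∩ q.2).Nonempty then (s.1 \ q.2, paint s.2 (s.1 ∩ q.2) q.1) else s)
        = Q * (1 - (if u ∈ q.2 then 1 else 0) - (if v ∈ q.2 then 1 else 0)
            + (if u ∈ q.2 ∧ v ∈ q.2 then 1 else 0))
          + (if φ s(u, v) = none then 0 else 1) * ((if u ∈ q.2 then 1 else 0)
            + (if v ∈ q.2 then 1 else 0) - 2 * (if u ∈ q.2 ∧ v ∈ q.2 then 1 else 0))
          + ((if u ∈ q.2 ∧ v ∈ q.2 then 1 else 0)
            - (if φ s(u, v) = some q.1 ∧ u ∈ q.2 ∧ v ∈ q.2 then 1 else 0)) := by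
      intro q
      by_cases hu : u ∈ q.2 <;> by_cases hv : v ∈ q.2
      · have h : (s.1 ∩ q.2).Nonempty := ⟨u, by simp [hu, hlive.1]⟩
        rw [if_pos h]
        by_cases hc : φ s(u, v) = some q.1
        · simp [potential, disagreement, paint, hu, hv, hlive, hc]
          norm_num
        · have hc' : ¬ some q.1 = φ s(u, v) := fun h => hc h.symm
          simp [potential, disagreement, paint, hu, hv, hlive, hc, hc']
          norm_num
      · have h : (s.1 ∩ q.2).Nonempty := ⟨u, by simp [hu, hlive.1]⟩
        rw [if_pos h]
        simp [potential, disagreement, paint, hu, hv, hnone, eq_comm (a := φ s(u, v))]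
      · have h : (s.1 ∩ q.2).Nonempty := ⟨v, by simp [hv, hlive.2]⟩
        rw [if_pos h]
        simp [potential, disagreement, paint, hu, hv, hnone, eq_comm (a := φ s(u, v))]
      · split_ifs <;> simp_all [potential]
    simp only [hstep]
    have hcol : ∑ q : L × Finset V, (weight z.z q).toReal *
        (if φ s(u, v) = some q.1 ∧ u ∈ q.2 ∧ v ∈ q.2 then 1 else 0)
        = match φ s(u, v) with
          | some c => 1 - xEdge z.z c s(u, v)
          | none => 0 := by
      cases h : φ s(u, v) with
      | none => simp
      | some c => simp only [Option.some.injEq, eq_comm (a := c), sum_weight_edge_color]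
    have hsum : ∀ (a b : ℝ) (w A B C D : L × Finset V → ℝ),
        ∑ q, w q * (a * (1 - A q - B q + C q) + b * (A q + B q - 2 * C q) + (C q - D q))
          = a * (∑ q, w q - ∑ q, w q * A q - ∑ q, w q * B q + ∑ q, w q * C q)
            + b * (∑ q, w q * A q + ∑ q, w q * B q - 2 * ∑ q, w q * C q)
            + (∑ q, w q * C q - ∑ q, w q * D q) := by
      intro a b w A B C D
      simp only [Finset.mul_sum, ← Finset.sum_add_distrib, ← Finset.sum_sub_distrib]
      exact Finset.sum_congr rfl fun q _ => by ring
    rw [hsum, sum_weight_vertex, sum_weight_vertex, sum_weight_edge, hcol, ← totalMass]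
    have hpot : potential φ (clusterBound z φ) (fun e => ∀ a ∈ e, a ∈ s.1) s.2 s(u, v) = Q := by
      simp [potential, hlive, hQ]
    rw [hpot]
    have hy0 := joinMass_nonneg z u v
    have hy1 := joinMass_le_one z u v
    have hy2 : 0 < 2 - joinMass z s(u, v) := by linarith
    cases h : φ s(u, v) with
    | none =>
      have hQe : Q * (2 - joinMass z s(u, v)) = joinMass z s(u, v) := by
        simp only [hQ, clusterBound, h]
        exact div_mul_cancel₀ _ hy2.ne'
      simp only [if_true]
      linarith
    | some c =>
      have hx := xEdge_nonneg z c u v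
      have hxy := one_sub_xEdge_le_joinMass z c u v
      have hx1 := xEdge_le_one z c u v
      have hQe : (2 - joinMass z s(u, v)) - (1 - xEdge z.z c s(u, v))
          ≤ Q * (2 - joinMass z s(u, v)) := by
        simp only [hQ, clusterBound, h]
        rw [div_mul_eq_mul_div, le_div_iff₀ (by linarith)]
        nlinarith [mul_nonneg (sub_nonneg.2 hx1) (sub_nonneg.2 hxy)]
      simp only [reduceCtorEq, if_false]
      linarith
  · have hlive' : ¬ ∀ a ∈ s(u, v), a ∈ s.1 := by simpa using hlive
    refine le_of_eq ?_
    rw [← expect_const (clusterBody z s) (potential φ (clusterBound z φ) _ s.2 s(u, v)),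
      clusterBody_eq z hne]
    refine expect_congr _ fun t ht => ?_
    simp only [PMF.mem_support_bind_iff, PMF.support_pure, Set.mem_singleton_iff] at ht
    obtain ⟨q, -, rfl⟩ := ht
    split_ifs with h
    · have h1 : ¬ ∀ a ∈ s(u, v), a ∈ s.1 \ q.2 := fun h' =>
        hlive' fun a ha => (Finset.mem_sdiff.1 (h' a ha)).1
      have h2 : ¬ ∀ a ∈ s(u, v), a ∈ s.1 ∩ q.2 := fun h' =>
        hlive' fun a ha => (Finset.mem_inter.1 (h' a ha)).1
      simp only [potential, if_neg h1, if_neg hlive', disagreement, paint, if_neg h2]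
    · rfl

theorem expected_cost_cluster_le (φ : Sym2 V → Option L) :
    ∑ Φ, (clusterLaw z Φ).toReal * (cost φ Φ : ℝ) ≤ ∑ e ∈ edges V, clusterBound z φ e := by
  have h := expect_output_le (halted := fun s : Finset V × (Sym2 V → Option L) => s.1 = ∅)
    (I := fun s => PartialClustering (s.1 : Set V) s.2) (clusterBody_invariant z)
    (U := fun s => ∑ e ∈ edges V,
      potential φ (clusterBound z φ) (fun e => ∀ a ∈ e, a ∈ s.1) s.2 e)
    (fun s => Finset.sum_nonneg fun e _ => potential_nonneg (clusterBound_nonneg z φ) _ _ e) ?_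
    Prod.snd (fun Φ => (cost φ Φ : ℝ)) ?_
    (s := (Finset.univ, fun _ => none)) (PartialClustering.init z _)
  · refine h.trans (le_of_eq (Finset.sum_congr rfl fun e _ => ?_))
    simp [potential]
  · intro s hs hh
    rw [expect_sum]
    exact Finset.sum_le_sum fun e he => expect_potential_clusterBody_le z φ hs
      (Finset.nonempty_iff_ne_empty.2 hh) he
  · intro s hh
    rw [cost_eq_sum]
    refine Finset.sum_le_sum fun e _ => ?_
    induction e with | _ u v
    have hlive : ¬ ∀ a ∈ s(u, v), a ∈ s.1 := fun h => by simpa [hh] using h u (by simp)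
    simp only [potential, if_neg hlive, le_refl]

theorem isClustering_of_clusterLaw_ne_zero {Φ : Sym2 V → Option L} (h : clusterLaw z Φ ≠ 0) :
    IsClustering Φ := by
  obtain ⟨t, ht, -, rfl⟩ := exists_of_loopLaw_ne_zero (clusterBody_invariant z) Prod.snd
    (PartialClustering.init z _) h
  exact ht.isClustering

theorem sum_clusterLaw : ∑ Φ, clusterLaw z Φ = 1 :=
  sum_loopLaw_eq_one _ (ne_top_of_le_ne_top (by finiteness) (clusterIterations_le z))

end Cluster

/-! ### The cluster of a pivot -/

theorem expect_coin (p : unitInterval) (g : Bool → ℝ) :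
    expect (coin p) g = p * g true + (1 - p) * g false := by
  simp [expect, coin, ENNReal.toReal_ofReal p.2.1, ENNReal.toReal_ofReal (sub_nonneg.2 p.2.2)]

theorem subset_of_mem_support_growCluster (p : V → unitInterval) :
    ∀ (l : List V) (C : Finset V), ∀ D ∈ (growCluster p l C).support,
      C ⊆ D ∧ ∀ a ∈ D, a ∈ C ∨ a ∈ l := by
  intro l
  induction l with
  | nil =>
    intro C D hD
    simp only [growCluster, PMF.support_pure, Set.mem_singleton_iff] at hD
    subst hD
    simp
  | cons v l ih =>
    intro C D hD
    simp only [growCluster, PMF.mem_support_bind_iff] at hD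
    obtain ⟨b, -, hD⟩ := hD
    obtain ⟨h1, h2⟩ := ih _ D hD
    cases b
    · refine ⟨(Finset.subset_insert v C).trans h1, fun a ha => ?_⟩
      have := h2 a ha
      simp only [Bool.false_eq_true, if_false, Finset.mem_insert] at this
      simp only [List.mem_cons]
      tauto
    · refine ⟨h1, fun a ha => ?_⟩
      have := h2 a ha
      simp only [if_true] at this
      simp only [List.mem_cons]
      tauto

/-- The vertices stay outside the cluster independently of each other. -/
theorem expect_growCluster (p : V → unitInterval) (T : Finset V) :
    ∀ (l : List V) (C : Finset V), l.Nodup → (∀ a ∈ l, a ∉ C) →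
      expect (growCluster p l C) (fun D => ∏ a ∈ T, if a ∈ D then (0 : ℝ) else 1)
        = ∏ a ∈ T, if a ∈ C then (0 : ℝ) else if a ∈ l then (p a : ℝ) else 1 := by
  intro l
  induction l with
  | nil => intro C _ _; simp [growCluster, expect_pure]
  | cons v l ih =>
    intro C hl hC
    rw [List.nodup_cons] at hl
    have hvC : v ∉ C := hC v (by simp)
    rw [growCluster, expect_bind, expect_coin]
    simp only [if_true, Bool.false_eq_true, if_false]
    rw [ih C hl.2 fun a ha => hC a (by simp [ha]), ih (insert v C) hl.2 ?_]
    · by_cases hvT : v ∈ T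
      · rw [Finset.prod_eq_zero (f := fun a => if a ∈ insert v C then (0 : ℝ) else
            if a ∈ l then (p a : ℝ) else 1) hvT (by simp), mul_zero, add_zero,
          ← Finset.mul_prod_erase _ _ hvT,
          ← Finset.mul_prod_erase (a := v) T (fun a => if a ∈ C then (0 : ℝ) else
            if a ∈ v :: l then (p a : ℝ) else 1) hvT]
        simp only [hvC, hl.1, if_false, one_mul, List.mem_cons, true_or, if_true]
        congr 1
        refine Finset.prod_congr rfl fun a ha => ?_
        simp [Finset.ne_of_mem_erase ha]
      · have h : ∀ a ∈ T, a ≠ v := fun a ha hav => hvT (hav ▸ ha)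
        rw [← Finset.prod_congr rfl fun a ha => show (if a ∈ C then (0 : ℝ) else if a ∈ l then
          (p a : ℝ) else 1) = if a ∈ insert v C then 0 else if a ∈ l then (p a : ℝ) else 1 by
            simp [h a ha], ← add_mul, add_sub_cancel, one_mul]
        refine Finset.prod_congr rfl fun a ha => ?_
        simp [h a ha]
    · intro a ha
      rw [Finset.mem_insert, not_or]
      exact ⟨fun hav => hl.1 (hav ▸ ha), hC a (by simp [ha])⟩

theorem sepProb_comm (φ : Sym2 V → Option L) (z : L → Finset V → ℝ) (f : Rounding) (c : L)
    (u v : V) : sepProb φ z f c u v = sepProb φ z f c v u := by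
  simp only [sepProb, Sym2.eq_swap (a := u), eq_comm (a := u)]

/-- The law of the cluster of the pivot `w`, chosen from the remaining vertices `R` of the
color `c`. -/
noncomputable def pivotCluster (φ : Sym2 V → Option L) (z : L → Finset V → ℝ) (f : Rounding)
    (c : L) (R : Finset V) (w : V) : PMF (Finset V) :=
  growCluster (sepProb φ z f c w) (R.erase w).toList {w}

section PivotCluster

variable (φ : Sym2 V → Option L) (z : L → Finset V → ℝ) (f : Rounding) (c : L) {R : Finset V}
  {w : V}

theorem mem_of_mem_support_pivotCluster (hw : w ∈ R) {C : Finset V}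
    (hC : C ∈ (pivotCluster φ z f c R w).support) : w ∈ C ∧ C ⊆ R := by
  obtain ⟨h1, h2⟩ := subset_of_mem_support_growCluster _ _ _ C hC
  refine ⟨h1 (by simp), fun a ha => ?_⟩
  have := h2 a ha
  simp only [Finset.mem_singleton, Finset.mem_toList, Finset.mem_erase] at this
  rcases this with rfl | h
  exacts [hw, h.2]

theorem expect_pivotCluster {T : Finset V} (hT : T ⊆ R) :
    expect (pivotCluster φ z f c R w) (fun C => ∏ a ∈ T, if a ∈ C then (0 : ℝ) else 1)
      = ∏ a ∈ T, (sepProb φ z f c a w : ℝ) := by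
  rw [pivotCluster, expect_growCluster _ _ _ _ (Finset.nodup_toList _) (by simp +contextual)]
  refine Finset.prod_congr rfl fun a ha => ?_
  by_cases haw : a = w
  · subst haw
    simp [sepProb]
  · simp [haw, hT ha, sepProb_comm φ z f c w a]

theorem expect_pivotCluster_vertex {u : V} (hu : u ∈ R) :
    expect (pivotCluster φ z f c R w) (fun C => if u ∈ C then (0 : ℝ) else 1)
      = sepProb φ z f c u w := by
  simpa only [Finset.prod_singleton] using
    expect_pivotCluster φ z f c (w := w) (Finset.singleton_subset_iff.2 hu)

theorem expect_pivotCluster_pair {u v : V} (hu : u ∈ R) (hv : v ∈ R) (huv : u ≠ v) :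
    expect (pivotCluster φ z f c R w)
      (fun C => (if u ∈ C then (0 : ℝ) else 1) * (if v ∈ C then (0 : ℝ) else 1))
      = sepProb φ z f c u w * sepProb φ z f c v w := by
  have h := expect_pivotCluster φ z f c (w := w) (T := {u, v})
    (Finset.insert_subset_iff.2 ⟨hu, Finset.singleton_subset_iff.2 hv⟩)
  simpa only [Finset.prod_pair huv] using h

end PivotCluster

/-! ### One iteration of pivot-based rounding -/

theorem currentColor_eq_none {R : L → Finset V} : currentColor R = none ↔ ∀ c, R c = ∅ := by
  simp [currentColor, List.find?_eq_none]

theorem nonempty_of_currentColor {R : L → Finset V} {c : L} (h : currentColor R = some c) :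
    (R c).Nonempty := by
  simpa using List.find?_some h

theorem exists_currentColor {R : L → Finset V} (h : ¬ ∀ c, R c = ∅) :
    ∃ c, currentColor R = some c := by
  rwa [← currentColor_eq_none, ← ne_eq, Option.ne_none_iff_exists'] at h

/-- The state after the cluster `C` of color `c` has been made. -/
def pivotStep (s : (L → Finset V) × (Sym2 V → Option L)) (c : L) (C : Finset V) :
    (L → Finset V) × (Sym2 V → Option L) :=
  (Function.update s.1 c (s.1 c \ C), paint s.2 C c)

theorem pivotBody_eq (φ : Sym2 V → Option L) (z : L → Finset V → ℝ) (f : Rounding)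
    {s : (L → Finset V) × (Sym2 V → Option L)} {c : L} (hc : currentColor s.1 = some c) :
    pivotBody φ z f s = (PMF.uniformOfFinset (s.1 c) (nonempty_of_currentColor hc)).bind fun w =>
      (pivotCluster φ z f c (s.1 c) w).bind fun C => PMF.pure (pivotStep s c C) := by
  simp only [pivotBody, hc, nonempty_of_currentColor hc, dif_pos]
  rfl

theorem mem_support_pivotBody {φ : Sym2 V → Option L} {z : L → Finset V → ℝ} {f : Rounding}
    {s t : (L → Finset V) × (Sym2 V → Option L)} {c : L} (hc : currentColor s.1 = some c)
    (ht : t ∈ (pivotBody φ z f s).support) :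
    ∃ C ⊆ s.1 c, C.Nonempty ∧ t = pivotStep s c C := by
  rw [pivotBody_eq φ z f hc] at ht
  simp only [PMF.mem_support_bind_iff, PMF.support_pure, Set.mem_singleton_iff,
    PMF.mem_support_uniformOfFinset_iff] at ht
  obtain ⟨w, hw, C, hC, rfl⟩ := ht
  obtain ⟨h1, h2⟩ := mem_of_mem_support_pivotCluster φ z f c hw hC
  exact ⟨C, h2, ⟨w, h1⟩, rfl⟩

theorem expect_uniformOfFinset {σ : Type*} [Fintype σ] {R : Finset σ} (hR : R.Nonempty)
    (g : σ → ℝ) : expect (PMF.uniformOfFinset R hR) g = (∑ w ∈ R, g w) / R.card := by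
  classical
  simp only [expect, PMF.uniformOfFinset_apply]
  rw [← Finset.sum_subset (Finset.subset_univ R), Finset.sum_div]
  · refine Finset.sum_congr rfl fun w hw => ?_
    simp [hw, div_eq_inv_mul]
  · intro w _ hw
    simp [hw]

theorem expect_pivotBody (φ : Sym2 V → Option L) (z : L → Finset V → ℝ) (f : Rounding)
    {s : (L → Finset V) × (Sym2 V → Option L)} {c : L} (hc : currentColor s.1 = some c)
    (g : (L → Finset V) × (Sym2 V → Option L) → ℝ) :
    expect (pivotBody φ z f s) g = (∑ w ∈ s.1 c, expect (pivotCluster φ z f c (s.1 c) w)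
      fun C => g (pivotStep s c C)) / (s.1 c).card := by
  simp only [pivotBody_eq φ z f hc, expect_bind, expect_pure, expect_uniformOfFinset]

/-- The invariant of pivot-based rounding. -/
def PivotInvariant (z : LPSolution V L) (s : (L → Finset V) × (Sym2 V → Option L)) : Prop :=
  (∀ c, s.1 c ⊆ majority z.z c) ∧ PartialClustering {a | ∃ c, a ∈ s.1 c} s.2

section Pivot

variable (φ : Sym2 V → Option L) (z : LPSolution V L) (f : Rounding)

theorem PivotInvariant.init : PivotInvariant z (majority z.z, fun _ => none) :=
  ⟨fun _ => subset_rfl, PartialClustering.init z _⟩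

theorem PivotInvariant.eq_of_mem {z : LPSolution V L}
    {s : (L → Finset V) × (Sym2 V → Option L)} (hs : PivotInvariant z s) {c c' : L} {u : V}
    (h : u ∈ s.1 c) (h' : u ∈ s.1 c') : c = c' :=
  eq_of_mem_majority z (hs.1 c h) (hs.1 c' h')

theorem mem_pivotStep {s : (L → Finset V) × (Sym2 V → Option L)} {c c' : L} {C : Finset V}
    {a : V} : a ∈ (pivotStep s c C).1 c' ↔ a ∈ s.1 c' ∧ (c' = c → a ∉ C) := by
  by_cases h : c' = c
  · subst h
    simp [pivotStep]
  · simp [pivotStep, h]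

theorem PivotInvariant.step {z : LPSolution V L} {s : (L → Finset V) × (Sym2 V → Option L)}
    (hs : PivotInvariant z s) {c : L} {C : Finset V} (hC : C ⊆ s.1 c) (hne : C.Nonempty) :
    PivotInvariant z (pivotStep s c C) := by
  refine ⟨fun c' a ha => hs.1 c' (mem_pivotStep.1 ha).1, ?_⟩
  refine hs.2.paint hne (fun a ha => ⟨c, hC ha⟩) ?_ c
  rintro a ⟨c', ha⟩
  rw [mem_pivotStep] at ha
  exact ⟨⟨c', ha.1⟩, fun haC => ha.2 (hs.eq_of_mem ha.1 (hC haC)) haC⟩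

theorem pivotBody_invariant (s : (L → Finset V) × (Sym2 V → Option L))
    (hs : PivotInvariant z s) (hh : ¬ ∀ c, s.1 c = ∅) :
    ∀ t ∈ (pivotBody φ z.z f s).support, PivotInvariant z t := by
  intro t ht
  obtain ⟨c, hc⟩ := exists_currentColor hh
  obtain ⟨C, hC, hne, rfl⟩ := mem_support_pivotBody hc ht
  exact hs.step hC hne

theorem sum_card_majority_le : ∑ c, (majority z.z c).card ≤ Fintype.card V := by
  rw [← Finset.card_biUnion]
  · exact Finset.card_le_univ _
  · intro c _ c' _ hcc'
    exact Finset.disjoint_left.2 fun a ha ha' => hcc' (eq_of_mem_majority z ha ha')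

/-- Every iteration removes at least the pivot, and the sets `V_c` are disjoint. -/
theorem pivotIterations_le : pivotIterations φ z f ≤ (Fintype.card V : ℝ≥0∞) ^ 2 := by
  have h := loopIterations_le
    (halted := fun s : (L → Finset V) × (Sym2 V → Option L) => ∀ c, s.1 c = ∅)
    (pivotBody_invariant φ z f) (W := fun s => ((∑ c, (s.1 c).card : ℕ) : ℝ))
    (fun s => Nat.cast_nonneg _) ?_ (PivotInvariant.init z)
  · refine h.trans ?_
    rw [ENNReal.ofReal_natCast, ← Nat.cast_pow]
    exact_mod_cast (sum_card_majority_le z).trans (Nat.le_self_pow two_ne_zero _)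
  · intro s _ hh
    obtain ⟨c, hc⟩ := exists_currentColor hh
    rw [← le_sub_iff_add_le, ← expect_const (pivotBody φ z.z f s) (_ - 1)]
    refine expect_mono _ fun t ht => ?_
    obtain ⟨C, hC, hne, rfl⟩ := mem_support_pivotBody hc ht
    rw [le_sub_iff_add_le]
    have h1 : ∀ c', ((pivotStep s c C).1 c').card ≤ (s.1 c').card := fun c' =>
      Finset.card_le_card fun a ha => (mem_pivotStep.1 ha).1
    have h2 : ((pivotStep s c C).1 c).card < (s.1 c).card := by
      obtain ⟨w, hw⟩ := hne
      refine Finset.card_lt_card (Finset.ssubset_iff_subset_ne.2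
        ⟨fun a ha => (mem_pivotStep.1 ha).1, fun he => ?_⟩)
      exact (mem_pivotStep.1 (he.symm ▸ hC hw : w ∈ (pivotStep s c C).1 c)).2 rfl hw
    exact_mod_cast Nat.succ_le_of_lt
      (Finset.sum_lt_sum (fun c' _ => h1 c') ⟨c, Finset.mem_univ c, h2⟩)

theorem isClustering_of_pivotLaw_ne_zero {Φ : Sym2 V → Option L} (h : pivotLaw φ z f Φ ≠ 0) :
    IsClustering Φ := by
  obtain ⟨t, ht, -, rfl⟩ := exists_of_loopLaw_ne_zero (pivotBody_invariant φ z f) Prod.snd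
    (PivotInvariant.init z) h
  exact ht.2.isClustering

theorem sum_pivotLaw : ∑ Φ, pivotLaw φ z f Φ = 1 :=
  sum_loopLaw_eq_one _ (ne_top_of_le_ne_top (by finiteness) (pivotIterations_le φ z f))

/-! ### The expected cost of pivot-based rounding -/

/-- The part of the target `α · lp(e)` that cluster-based rounding leaves for pivot-based
rounding, per unit of its probability `1 - α / 2`. -/
noncomputable def pivotBound (α : ℝ) (e : Sym2 V) : ℝ :=
  α / (1 - α / 2) *
    match φ e with
    | some c => xEdge z.z c e ^ 2 / (1 + xEdge z.z c e)
    | none => joinMass z e * (3 - 2 * joinMass z e) / (2 * (2 - joinMass z e))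

theorem pivotBound_nonneg {α : ℝ} (hα0 : 0 ≤ α) (hα : α < 2) (e : Sym2 V) :
    0 ≤ pivotBound φ z α e := by
  induction e with | _ u v
  refine mul_nonneg (div_nonneg hα0 (by linarith)) ?_
  split
  · next c _ =>
    have := xEdge_nonneg z c u v
    positivity
  · have h0 := joinMass_nonneg z u v
    have h1 := joinMass_le_one z u v
    exact div_nonneg (mul_nonneg h0 (by linarith)) (by linarith)

theorem sq_div_one_add_mono {a b : ℝ} (ha : 0 ≤ a) (hab : a ≤ b) :
    a ^ 2 / (1 + a) ≤ b ^ 2 / (1 + b) := by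
  rw [div_le_div_iff₀ (by linarith) (by linarith)]
  nlinarith [mul_nonneg ha (sub_nonneg.2 hab), mul_nonneg (mul_nonneg ha (ha.trans hab))
    (sub_nonneg.2 hab), mul_nonneg (ha.trans hab) (sub_nonneg.2 hab)]

theorem mul_div_two_sub_mono {a b : ℝ} (hab : a ≤ b) (hb : b ≤ 1) :
    a * (3 - 2 * a) / (2 * (2 - a)) ≤ b * (3 - 2 * b) / (2 * (2 - b)) := by
  rw [div_le_div_iff₀ (by linarith) (by linarith)]
  -- The difference of the two sides is `4 (b - a) ((1 - a) (1 - b) + (1 - a) + (1 - b))`.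
  nlinarith [mul_nonneg (sub_nonneg.2 hab) (mul_nonneg (sub_nonneg.2 hb)
    (sub_nonneg.2 (hab.trans hb))), mul_nonneg (sub_nonneg.2 hab) (sub_nonneg.2 hb),
    mul_nonneg (sub_nonneg.2 hab) (sub_nonneg.2 (hab.trans hb))]

/-- The charging factors never exceed the bound. For a `∘` edge of color `c'` this holds because
more than half of the mass of `u` has color `c`, and the masses of the colors `c` and `c'` at `u`
and at `v` add up to at most `1`, so that each of the four terms of the maximum `m` is at most
`x_{uv}^{c'}`. -/
theorem budget_le_pivotBound {α : ℝ} (hα0 : 0 ≤ α) (hα : α < 2) {c : L} {u v : V}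
    (hu : u ∈ majority z.z c) (w : V) :
    budget α φ z.z c w u v ≤ pivotBound φ z α s(u, v) := by
  refine mul_le_mul_of_nonneg_left ?_ (div_nonneg hα0 (by linarith))
  cases h : φ s(u, v) with
  | none =>
    simp only [edgeSign, h]
    refine le_trans (le_of_eq ?_) (mul_div_two_sub_mono (one_sub_xEdge_le_joinMass z c u v)
      (joinMass_le_one z u v))
    congr 1 <;> ring
  | some c' =>
    by_cases hcc : c' = c
    · simp [edgeSign, h, hcc]
    · simp only [edgeSign, h, hcc, if_false]
      simp only [majority, Finset.mem_filter] at hu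
      refine sq_div_one_add_mono (le_max_of_le_left (le_max_of_le_left (by norm_num))) ?_
      have hu' := one_sub_xVertex_add_le_one z hcc u
      have hv' := one_sub_xVertex_add_le_one z hcc v
      have h1 := xVertex_le_xEdge_left z c' u v
      have h2 := xVertex_le_xEdge_right z c' u v
      have h3 := xVertex_le_xEdge_left z c u v
      have h4 := xVertex_le_xEdge_left z c v w
      have h5 := xVertex_le_xEdge_right z c w u
      refine max_le (max_le ?_ ?_) (max_le ?_ ?_) <;> linarith

/-- `e` lies inside one of the sets of remaining vertices. -/
def Live (R : L → Finset V) (e : Sym2 V) : Prop := ∃ c, ∀ a ∈ e, a ∈ R c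

/-- Given the pivot `w`, the edge `uv` stays undecided with probability `p_{uw} p_{vw}`, and it
becomes violated with probability `e.cost_w(uv)`. -/
theorem expect_potential_pivotCluster {s : (L → Finset V) × (Sym2 V → Option L)}
    (hs : PivotInvariant z s) (Q : Sym2 V → ℝ) {c : L} {u v : V} (hu : u ∈ s.1 c)
    (hv : v ∈ s.1 c) (huv : u ≠ v) (w : V) :
    expect (pivotCluster φ z.z f c (s.1 c) w) (fun C =>
        potential φ Q (Live (pivotStep s c C).1) (pivotStep s c C).2 s(u, v))
      = sepProb φ z.z f c u w * sepProb φ z.z f c v w * Q s(u, v)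
        + eCost φ z.z f c w u v := by
  have hnone := hs.2.apply_eq_none huv ⟨c, hu⟩
  have hlive : ∀ C, Live (pivotStep s c C).1 s(u, v) ↔ u ∉ C ∧ v ∉ C := by
    intro C
    simp only [Live, Sym2.mem_iff, forall_eq_or_imp, forall_eq, mem_pivotStep]
    constructor
    · rintro ⟨c', ⟨h1, h2⟩, -, h3⟩
      have hcc := hs.eq_of_mem h1 hu
      exact ⟨h2 hcc, h3 hcc⟩
    · exact fun h => ⟨c, ⟨hu, fun _ => h.1⟩, hv, fun _ => h.2⟩
  -- The new potential is a polynomial in the indicators of `u ∉ C` and `v ∉ C`.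
  have hstep : ∀ C, potential φ Q (Live (pivotStep s c C).1) (pivotStep s c C).2 s(u, v)
      = ((if u ∈ C then (0 : ℝ) else 1) * (if v ∈ C then (0 : ℝ) else 1))
          * (Q s(u, v) + (if φ s(u, v) = some c then 0 else 1)
            - 2 * (if φ s(u, v) = none then 0 else 1))
        + (if u ∈ C then (0 : ℝ) else 1) * ((if φ s(u, v) = none then 0 else 1)
            - (if φ s(u, v) = some c then 0 else 1))
        + (if v ∈ C then (0 : ℝ) else 1) * ((if φ s(u, v) = none then 0 else 1)
            - (if φ s(u, v) = some c then 0 else 1))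
        + (if φ s(u, v) = some c then 0 else 1) := by
    intro C
    by_cases hu' : u ∈ C <;> by_cases hv' : v ∈ C
    · simp only [potential, hlive, hu', hv', not_true_eq_false, and_self, if_false]
      simp [disagreement, pivotStep, paint, hu', hv', eq_comm (b := φ s(u, v))]
    · simp only [potential, hlive, hu', hv', not_true_eq_false, not_false_eq_true, false_and,
        if_false]
      simp [disagreement, pivotStep, paint, hu', hv', hnone, eq_comm (b := φ s(u, v))]
    · simp only [potential, hlive, hu', hv', not_true_eq_false, not_false_eq_true, and_false,
        if_false]
      simp [disagreement, pivotStep, paint, hu', hv', hnone, eq_comm (b := φ s(u, v))]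
    · simp only [potential, hlive, hu', hv', not_false_eq_true, and_self, if_true, if_false]
      ring
  simp only [hstep]
  rw [expect_add, expect_add, expect_add, expect_mul_const, expect_mul_const, expect_mul_const,
    expect_const, expect_pivotCluster_pair φ z.z f c hu hv huv,
    expect_pivotCluster_vertex φ z.z f c hu, expect_pivotCluster_vertex φ z.z f c hv]
  simp only [eCost, huv, if_false]
  cases h : φ s(u, v) with
  | none => simp only [edgeSign, h, if_true, reduceCtorEq, if_false]; ring
  | some c' =>
    by_cases hcc : c' = c
    · simp only [edgeSign, h, hcc, if_true, reduceCtorEq, if_false]; ring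
    · simp only [edgeSign, h, hcc, Option.some.injEq, reduceCtorEq, if_false]; ring

theorem potential_pivotStep_of_not_subset {s : (L → Finset V) × (Sym2 V → Option L)}
    (Q : Sym2 V → ℝ) {c : L} {C : Finset V} (hC : C ⊆ s.1 c) {e : Sym2 V}
    (he : ¬ ∀ a ∈ e, a ∈ s.1 c) :
    potential φ Q (Live (pivotStep s c C).1) (pivotStep s c C).2 e
      = potential φ Q (Live s.1) s.2 e := by
  have hlive : Live (pivotStep s c C).1 e ↔ Live s.1 e := by
    constructor
    · rintro ⟨c', h⟩
      exact ⟨c', fun a ha => (mem_pivotStep.1 (h a ha)).1⟩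
    · rintro ⟨c', h⟩
      have hcc : c' ≠ c := fun hcc => he (hcc ▸ h)
      exact ⟨c', fun a ha => mem_pivotStep.2 ⟨h a ha, fun hcc' => absurd hcc' hcc⟩⟩
  have hpaint : ¬ ∀ a ∈ e, a ∈ C := fun h => he fun a ha => hC (h a ha)
  by_cases h : Live s.1 e
  · rw [potential, potential, if_pos h, if_pos (hlive.2 h)]
  · rw [potential, potential, if_neg h, if_neg (mt hlive.1 h)]
    simp only [disagreement, pivotStep, paint, if_neg hpaint]

theorem sum_offDiag_mk (R : Finset V) (g : Sym2 V → ℝ) :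
    ∑ p ∈ R.offDiag, g s(p.1, p.2) = 2 * ∑ e ∈ (edges V).filter (fun e => ∀ a ∈ e, a ∈ R), g e := by
  rw [← Finset.sum_fiberwise_of_maps_to (s := R.offDiag)
    (t := (edges V).filter (fun e => ∀ a ∈ e, a ∈ R)) (g := fun p => s(p.1, p.2)), Finset.mul_sum]
  · refine Finset.sum_congr rfl fun e he => ?_
    induction e with | _ u v
    simp only [Finset.mem_filter, mk_mem_edges, Sym2.mem_iff, forall_eq_or_imp, forall_eq] at he
    have h : R.offDiag.filter (fun p => s(p.1, p.2) = s(u, v)) = {(u, v), (v, u)} := by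
      ext ⟨a, b⟩
      simp only [Finset.mem_filter, Finset.mem_offDiag, Sym2.eq_iff, Finset.mem_insert,
        Finset.mem_singleton, Prod.mk.injEq]
      constructor
      · exact fun h => h.2
      · rintro (⟨rfl, rfl⟩ | ⟨rfl, rfl⟩)
        · exact ⟨⟨he.2.1, he.2.2, he.1⟩, Or.inl ⟨rfl, rfl⟩⟩
        · exact ⟨⟨he.2.2, he.2.1, he.1.symm⟩, Or.inr ⟨rfl, rfl⟩⟩
    rw [h, Finset.sum_pair (by simpa using fun h => absurd h he.1), Sym2.eq_swap (a := v), two_mul]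
  · rintro ⟨a, b⟩ h
    simp only [Finset.mem_offDiag] at h
    simp [mk_mem_edges, h]

/-- The triangle inequality, summed over all triangles of remaining vertices: each ordered pair
together with a pivot occurs in three of the triangle sums. -/
theorem sum_eCost_le_sum_eLp {α : ℝ} {c : L} {R : Finset V}
    (h : ∀ u ∈ R, ∀ v ∈ R, ∀ w ∈ R, ALG φ z.z f c u v w ≤ LP α φ z.z f c u v w) :
    ∑ w ∈ R, ∑ u ∈ R, ∑ v ∈ R, eCost φ z.z f c w u v
      ≤ ∑ w ∈ R, ∑ u ∈ R, ∑ v ∈ R, eLp α φ z.z f c w u v := by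
  have key : ∀ F : V → V → V → ℝ,
      ∑ u ∈ R, ∑ v ∈ R, ∑ w ∈ R, (F w u v + F u v w + F v w u)
        = 3 * ∑ w ∈ R, ∑ u ∈ R, ∑ v ∈ R, F w u v := by
    intro F
    have h1 : ∑ u ∈ R, ∑ v ∈ R, ∑ w ∈ R, F w u v = ∑ w ∈ R, ∑ u ∈ R, ∑ v ∈ R, F w u v := by
      rw [Finset.sum_comm]
      rw [Finset.sum_congr rfl fun v _ => Finset.sum_comm]
      rw [Finset.sum_comm]
      exact Finset.sum_congr rfl fun w _ => Finset.sum_comm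
    have h2 : ∑ u ∈ R, ∑ v ∈ R, ∑ w ∈ R, F v w u = ∑ w ∈ R, ∑ u ∈ R, ∑ v ∈ R, F w u v := by
      rw [Finset.sum_comm]
      exact Finset.sum_congr rfl fun w _ => Finset.sum_comm
    simp only [Finset.sum_add_distrib, h1, h2]
    ring
  have hsum : ∑ u ∈ R, ∑ v ∈ R, ∑ w ∈ R, ALG φ z.z f c u v w
      ≤ ∑ u ∈ R, ∑ v ∈ R, ∑ w ∈ R, LP α φ z.z f c u v w :=
    Finset.sum_le_sum fun u hu => Finset.sum_le_sum fun v hv =>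
      Finset.sum_le_sum fun w hw => h u hu v hv w hw
  simp only [ALG, LP] at hsum
  rw [key (eCost φ z.z f c), key (eLp α φ z.z f c)] at hsum
  linarith

variable {φ z f}

/-- In one iteration the expected newly created cost is at most the expected decrease of the bounds
of the undecided edges. -/
theorem expect_potential_pivotBody_le {α : ℝ} (hα0 : 0 ≤ α) (hα : α < 2)
    (htriangle : ∀ c : L, ∀ u ∈ majority z.z c, ∀ v ∈ majority z.z c,
      ∀ w ∈ majority z.z c, ALG φ z.z f c u v w ≤ LP α φ z.z f c u v w)
    {s : (L → Finset V) × (Sym2 V → Option L)} (hs : PivotInvariant z s)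
    (hh : ¬ ∀ c, s.1 c = ∅) :
    expect (pivotBody φ z.z f s)
        (fun t => ∑ e ∈ edges V, potential φ (pivotBound φ z α) (Live t.1) t.2 e)
      ≤ ∑ e ∈ edges V, potential φ (pivotBound φ z α) (Live s.1) s.2 e := by
  obtain ⟨c, hc⟩ := exists_currentColor hh
  have hcard : (0 : ℝ) < (s.1 c).card := by
    exact_mod_cast (nonempty_of_currentColor hc).card_pos
  rw [expect_pivotBody φ z.z f hc, div_le_iff₀ hcard, mul_comm, ← nsmul_eq_mul,
    ← Finset.sum_const, ← sub_nonpos, ← Finset.sum_sub_distrib]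
  simp only [expect_sum, ← Finset.sum_sub_distrib]
  set Q := pivotBound φ z α
  -- `D w e` is the expected change of the potential of `e`, given the pivot `w`.
  set D : V → Sym2 V → ℝ := fun w e => expect (pivotCluster φ z.z f c (s.1 c) w) (fun C =>
    potential φ Q (Live (pivotStep s c C).1) (pivotStep s c C).2 e)
      - potential φ Q (Live s.1) s.2 e with hD
  have hD0 : ∀ w ∈ s.1 c, ∀ e, (¬ ∀ a ∈ e, a ∈ s.1 c) → D w e = 0 := by
    intro w hw e he
    rw [hD, sub_eq_zero, ← expect_const (pivotCluster φ z.z f c (s.1 c) w)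
      (potential φ Q (Live s.1) s.2 e)]
    exact expect_congr _ fun C hC => potential_pivotStep_of_not_subset φ Q
      (mem_of_mem_support_pivotCluster φ z.z f c hw hC).2 he
  have hD1 : ∀ w ∈ s.1 c, ∑ e ∈ edges V, D w e
      = (∑ p ∈ (s.1 c).offDiag, D w s(p.1, p.2)) / 2 := by
    intro w hw
    rw [sum_offDiag_mk, mul_div_cancel_left₀ _ two_ne_zero, Finset.sum_filter]
    refine Finset.sum_congr rfl fun e _ => ?_
    split_ifs with h
    exacts [rfl, hD0 w hw e h]
  have hD2 : ∀ w ∈ s.1 c, ∑ p ∈ (s.1 c).offDiag, D w s(p.1, p.2)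
      ≤ ∑ u ∈ s.1 c, ∑ v ∈ s.1 c, (eCost φ z.z f c w u v - eLp α φ z.z f c w u v) := by
    intro w _
    rw [← Finset.sum_product', ← Finset.sum_subset (s₁ := (s.1 c).offDiag)
      (s₂ := s.1 c ×ˢ s.1 c)]
    · refine Finset.sum_le_sum fun p hp => ?_
      obtain ⟨u, v⟩ := p
      obtain ⟨hu, hv, huv⟩ := Finset.mem_offDiag.1 hp
      have hlive : Live s.1 s(u, v) := ⟨c, by simpa using ⟨hu, hv⟩⟩
      simp only [hD, expect_potential_pivotCluster φ z f hs Q hu hv huv w]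
      rw [potential, if_pos hlive, eLp, if_neg huv]
      have hp1 : 0 ≤ 1 - (sepProb φ z.z f c u w : ℝ) * (sepProb φ z.z f c v w : ℝ) :=
        sub_nonneg.2 (mul_le_one₀ (sepProb φ z.z f c u w).2.2 (sepProb φ z.z f c v w).2.1
          (sepProb φ z.z f c v w).2.2)
      have hle := mul_le_mul_of_nonneg_left
        (budget_le_pivotBound φ z hα0 hα (v := v) (hs.1 c hu) w) hp1
      linarith
    · intro p hp
      simp only [Finset.mem_offDiag, Finset.mem_product] at hp ⊢
      exact ⟨hp.1, hp.2.1⟩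
    · intro p hp hp'
      simp only [Finset.mem_offDiag, Finset.mem_product] at hp hp'
      have hpp : p.1 = p.2 := by tauto
      simp [eCost, eLp, hpp]
  have htri := sum_eCost_le_sum_eLp φ z f (α := α) (R := s.1 c) fun u hu v hv w hw =>
    htriangle c u (hs.1 c hu) v (hs.1 c hv) w (hs.1 c hw)
  rw [Finset.sum_congr rfl hD1, ← Finset.sum_div]
  have := Finset.sum_le_sum hD2
  simp only [Finset.sum_sub_distrib] at this
  linarith

theorem expected_cost_pivot_le {α : ℝ} (hα0 : 0 ≤ α) (hα : α < 2)
    (htriangle : ∀ c : L, ∀ u ∈ majority z.z c, ∀ v ∈ majority z.z c,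
      ∀ w ∈ majority z.z c, ALG φ z.z f c u v w ≤ LP α φ z.z f c u v w) :
    ∑ Φ, (pivotLaw φ z f Φ).toReal * (cost φ Φ : ℝ) ≤ ∑ e ∈ edges V,
      potential φ (pivotBound φ z α) (Live (majority z.z)) (fun _ => none) e := by
  refine expect_output_le
    (halted := fun s : (L → Finset V) × (Sym2 V → Option L) => ∀ c, s.1 c = ∅)
    (pivotBody_invariant φ z f)
    (U := fun s => ∑ e ∈ edges V, potential φ (pivotBound φ z α) (Live s.1) s.2 e)
    (fun s => Finset.sum_nonneg fun e _ =>
      potential_nonneg (pivotBound_nonneg φ z hα0 hα) _ _ e)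
    (fun s hs hh => expect_potential_pivotBody_le hα0 hα htriangle hs hh)
    Prod.snd (fun Φ => (cost φ Φ : ℝ)) ?_ (PivotInvariant.init z)
  intro s hh
  rw [cost_eq_sum]
  refine Finset.sum_le_sum fun e _ => ?_
  induction e with | _ u v
  have hlive : ¬ Live s.1 s(u, v) := by
    rintro ⟨c, h⟩
    simpa [hh c] using h u (by simp)
  simp only [potential, if_neg hlive, le_refl]

end Pivot

/-! ### The mixed algorithm -/

section Mixed

variable {φ : Sym2 V → Option L} {z : LPSolution V L}

/-- The mixture of the two bounds equals `α · lp(e)` inside the sets `V_c`. An edge of color `c`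
that does not lie inside one of them has `x_e^c ≥ 1/2`, and pivot-based rounding certainly violates
it; its bound `α x² / (1 + x) ≥ 1 - α / 2` is where `α ≥ 3/2` is needed. -/
theorem mixed_bound_le {α : ℝ} (hα : 3 / 2 ≤ α) (hα' : α < 2) (e : Sym2 V) :
    α / 2 * clusterBound z φ e + (1 - α / 2) *
        potential φ (pivotBound φ z α) (Live (majority z.z)) (fun _ => none) e
      ≤ α * match φ e with
        | some c => xEdge z.z c e
        | none => ∑ c, (1 - xEdge z.z c e) := by
  have hα1 : 0 < 1 - α / 2 := by linarith
  induction e with | _ u v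
  have hcancel : ∀ r : ℝ, (1 - α / 2) * (α / (1 - α / 2) * r) = α * r := by
    intro r
    rw [← mul_assoc, mul_div_cancel₀ _ hα1.ne']
  cases h : φ s(u, v) with
  | none =>
    have h0 := joinMass_nonneg z u v
    have h1 := joinMass_le_one z u v
    have h2 : 0 < 2 - joinMass z s(u, v) := by linarith
    simp only [potential, disagreement, clusterBound, pivotBound, h, if_true]
    rw [← joinMass]
    set y := joinMass z s(u, v)
    have hy : α / 2 * (y / (2 - y)) + α * (y * (3 - 2 * y) / (2 * (2 - y))) = α * y := by
      field_simp
      ring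
    split_ifs
    · rw [hcancel, hy]
    · rw [mul_zero, ← hy]
      have : 0 ≤ y * (3 - 2 * y) / (2 * (2 - y)) :=
        div_nonneg (mul_nonneg h0 (by linarith)) (by linarith)
      have := mul_nonneg (by linarith : 0 ≤ α) this
      linarith
  | some c =>
    have h0 := xEdge_nonneg z c u v
    have h1 := xVertex_le_xEdge_left z c u v
    have h2 := xVertex_le_xEdge_right z c u v
    simp only [potential, disagreement, clusterBound, pivotBound, h, reduceCtorEq, if_false]
    have hx : α / 2 * (2 * xEdge z.z c s(u, v) / (1 + xEdge z.z c s(u, v)))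
        + α * (xEdge z.z c s(u, v) ^ 2 / (1 + xEdge z.z c s(u, v)))
        = α * xEdge z.z c s(u, v) := by
      field_simp
    split_ifs with hlive
    · rw [hcancel, hx]
    · -- One end point is not in `V_c`, and `x_{uv}^c` is at least its `x_u^c`.
      have hhalf : 1 / 2 ≤ xEdge z.z c s(u, v) := by
        by_contra! hlt
        refine hlive ⟨c, ?_⟩
        simp only [Sym2.mem_iff, forall_eq_or_imp, forall_eq, majority, Finset.mem_filter,
          Finset.mem_univ, true_and]
        exact ⟨by linarith, by linarith⟩
      have hmono := sq_div_one_add_mono (by norm_num) hhalf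
      norm_num at hmono
      rw [← hx]
      nlinarith

theorem sum_mixedLaw {α : ℝ} (hα0 : 0 ≤ α) (hα : α ≤ 2) (f : Rounding) :
    ∑ Φ, mixedLaw α φ z f Φ = 1 := by
  simp only [mixedLaw, Finset.sum_add_distrib, ← Finset.mul_sum, sum_clusterLaw, sum_pivotLaw,
    mul_one]
  rw [← ENNReal.ofReal_add (by linarith) (by linarith), add_sub_cancel, ENNReal.ofReal_one]

theorem mixedIterations_le {α : ℝ} (hα0 : 0 ≤ α) (hα : α ≤ 2) (f : Rounding) :
    mixedIterations α φ z f ≤ (Fintype.card V : ℝ≥0∞) ^ 2 := by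
  refine (add_le_add (mul_le_mul_right (clusterIterations_le z) _)
    (mul_le_mul_right (pivotIterations_le φ z f) _)).trans (le_of_eq ?_)
  rw [← add_mul, ← ENNReal.ofReal_add (by linarith) (by linarith), add_sub_cancel,
    ENNReal.ofReal_one, one_mul]

theorem isClustering_of_mixedLaw_ne_zero {α : ℝ} {f : Rounding} {Φ : Sym2 V → Option L}
    (h : mixedLaw α φ z f Φ ≠ 0) : IsClustering Φ := by
  by_cases h1 : clusterLaw z Φ = 0
  · by_cases h2 : pivotLaw φ z f Φ = 0
    · simp [mixedLaw, h1, h2] at h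
    · exact isClustering_of_pivotLaw_ne_zero φ z f h2
  · exact isClustering_of_clusterLaw_ne_zero z h1

theorem expected_cost_mixed_le {α : ℝ} (hα : 3 / 2 ≤ α) (hα' : α < 2) {f : Rounding}
    (htriangle : ∀ c : L, ∀ u ∈ majority z.z c, ∀ v ∈ majority z.z c,
      ∀ w ∈ majority z.z c, ALG φ z.z f c u v w ≤ LP α φ z.z f c u v w) :
    ∑ Φ, (mixedLaw α φ z f Φ).toReal * (cost φ Φ : ℝ) ≤ α * lpObj φ z.z := by
  have h1 := expected_cost_cluster_le z φ
  have h2 := expected_cost_pivot_le (by linarith) hα' htriangle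
  have hlaw : ∀ Φ, (mixedLaw α φ z f Φ).toReal
      = α / 2 * (clusterLaw z Φ).toReal + (1 - α / 2) * (pivotLaw φ z f Φ).toReal := by
    intro Φ
    rw [mixedLaw, ENNReal.toReal_add, ENNReal.toReal_mul, ENNReal.toReal_mul,
      ENNReal.toReal_ofReal (by linarith), ENNReal.toReal_ofReal (by linarith)]
    · exact ENNReal.mul_ne_top ENNReal.ofReal_ne_top (loopLaw_ne_top _ _ _)
    · exact ENNReal.mul_ne_top ENNReal.ofReal_ne_top (loopLaw_ne_top _ _ _)
  simp only [hlaw, add_mul, mul_assoc, Finset.sum_add_distrib, ← Finset.mul_sum]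
  calc _ ≤ α / 2 * ∑ e ∈ edges V, clusterBound z φ e + (1 - α / 2) * ∑ e ∈ edges V,
        potential φ (pivotBound φ z α) (Live (majority z.z)) (fun _ => none) e :=
        add_le_add (mul_le_mul_of_nonneg_left h1 (by linarith))
          (mul_le_mul_of_nonneg_left h2 (by linarith))
    _ ≤ α * lpObj φ z.z := by
        rw [Finset.mul_sum, Finset.mul_sum, ← Finset.sum_add_distrib, lpObj, Finset.mul_sum]
        exact Finset.sum_le_sum fun e _ => mixed_bound_le hα hα' e

end Mixed

end CCC

theorem mainTheorem5 {V L : Type*} [Fintype V] [DecidableEq V] [Fintype L] [DecidableEq L]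
    (α : ℝ) (hα : 3 / 2 ≤ α) (hα' : α < 2) (f : CCC.Rounding)
    (φ : Sym2 V → Option L) (z : CCC.LPSolution V L)
    (htriangle : ∀ c : L, ∀ u ∈ CCC.majority z.z c, ∀ v ∈ CCC.majority z.z c,
      ∀ w ∈ CCC.majority z.z c, CCC.ALG φ z.z f c u v w ≤ CCC.LP α φ z.z f c u v w) :
    -- the algorithm terminates almost surely, after few iterations in expectation
    ∑ Φ, CCC.mixedLaw α φ z f Φ = 1 ∧
    CCC.mixedIterations α φ z f ≤ (Fintype.card V : ENNReal) ^ 2 ∧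
    -- its output is a chromatic clustering
    (∀ Φ, CCC.mixedLaw α φ z f Φ ≠ 0 → CCC.IsClustering Φ) ∧
    -- on a near-optimal LP solution, its expected cost is at most `α + ε` times the optimum
    ∀ ε : ℝ, 0 < ε → CCC.lpObj φ z.z ≤ (1 + ε / α) * (CCC.opt φ : ℝ) →
      ∑ Φ, (CCC.mixedLaw α φ z f Φ).toReal * (CCC.cost φ Φ : ℝ) ≤ (α + ε) * (CCC.opt φ : ℝ) := by
  have hα0 : 0 < α := by linarith
  refine ⟨CCC.sum_mixedLaw hα0.le hα'.le f, CCC.mixedIterations_le hα0.le hα'.le f,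
    fun Φ h => CCC.isClustering_of_mixedLaw_ne_zero h, fun ε _ hobj => ?_⟩
  refine (CCC.expected_cost_mixed_le hα hα' htriangle).trans ?_
  refine (mul_le_mul_of_nonneg_left hobj hα0.le).trans (le_of_eq ?_)
  field_simp
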